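/- Let $n,m\ge 1$, let $\ell,\ell_1,\dots,\ell_n$ be positive integers, put $\gamma=(\ell/\ell_1,\dots,\ell/\ell_n)$, $\|\gamma\|=\sum_k\gamma_k$, and $\alpha\cdot\gamma=\sum_k\alpha_k\gamma_k$ for multi-indices $\alpha$. Let $$\mathcal L=\sum_{\alpha\cdot\gamma=\ell}A_\alpha\,\partial^\alpha$$ be a differential operator on $\mathbb R^n$ with constant complex $m\times m$ matrix coefficients, of order $\ell=\max\{|\alpha|: A_\alpha\ne 0\}$, that is semielliptic: its symbol $L(z)=\sum_{\alpha\cdot\gamma=\ell}A_\alpha (iz)^\alpha$ is an invertible matrix for every nonzero $z\in\mathbb R^n$. Put $\sigma(z)=\sum_k z_k^{2\ell_k}$, $\rho(x)=\sigma(x)^{1/(2\ell)}$, $s^\gamma x=(s^{\gamma_1}x_1,\dots,s^{\gamma_n}x_n)$ for $s>0$, and for every multi-index $\beta$ (including $\beta=0$) define the $m\times m$ matrix functions $$J_\beta(x,t)=\int_{\mathbb R^n}e^{ix\cdot z}(iz)^\beta\sigma(z)e^{-t\sigma(z)}L(z)^{-1}\,dz,\qquad F_\beta(x)=(2\pi)^{-n}\int_0^\infty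 J_\beta(x,t)\,dt,$$ and $$F(x)=F_0(x)=(2\pi)^{-n}\int_0^\infty\int_{\mathbb R^n}e^{ix\cdot z}\sigma(z)e^{-t\sigma(z)}L(z)^{-1}\,dz\,dt .$$ Let $|M|=(\sum_{i,j}|m_{ij}|^2)^{1/2}$ for a matrix $M=(m_{ij})$. Suppose that $\|\gamma\|>\ell$. Then: (a) for every multi-index $\beta$ and every $x\ne 0$, the integral defining $J_\beta(x,t)$ converges absolutely for each $t>0$, the integral over $t\in(0,\infty)$ defining $F_\beta(x)$ converges absolutely, and there is a constant $C$ depending only on $\mathcal L$ and $\beta$ such that $|F_\beta(x)|\le C\,\rho(x)^{\ell-\beta\cdot\gamma-\|\gamma\|}$ for all $x\neq 0$; (b) $F\in C^\infty(\mathbb R^n\setminus\{0\})$, and $\partial^\beta F(x)=F_\beta(x)$ for all multi-indices $\beta$ and all $x\neq0$; (c) for all multi-indices $\beta$, all $s>0$ and all $x\in\mathbb R^n$, $F_\beta(s^\gamma x)=s^{\ell-\beta\cdot\gamma-\|\gamma\|}F_\beta(x)$ (at $x=0$, an entry of $F_\beta(0)$ whose defining integral diverges is read as $0$); (d) $\mathcal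 LF(x)=0$ for all $x\in\mathbb R^n\setminus\{0\}$, where $\mathcal LF=\sum_{\alpha\cdot\gamma=\ell}A_\alpha\,\partial^\alpha F$. -/

import Mathlib

open MeasureTheory Set
open scoped ContDiff

noncomputable section

namespace Semielliptic

/-- The pairing `α · γ = α₁ γ₁ + ⋯ + αₙ γₙ` of a multi-index with a real vector. -/
def dot {n : ℕ} (α : Fin n → ℕ) (γ : Fin n → ℝ) : ℝ := ∑ k, (α k : ℝ) * γ k

/-- The vector `γ = (ℓ/ℓ₁, …, ℓ/ℓₙ)`. -/
def weight {n : ℕ} (l : ℕ) (ls : Fin n → ℕ) : Fin n → ℝ := fun k => (l : ℝ) / (ls k : ℝ)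

/-- The finite set of all multi-indices `α` with `α · γ = ℓ`, where `γ = (ℓ/ℓ₁, …, ℓ/ℓₙ)`.
The bound `α ≤ (ℓ₁, …, ℓₙ)` only makes the set finite: see `mem_indices`. -/
def indices {n : ℕ} (l : ℕ) (ls : Fin n → ℕ) : Finset (Fin n → ℕ) :=
  (Finset.Iic ls).filter (fun α => dot α (weight l ls) = l)

theorem mem_indices {n : ℕ} {l : ℕ} (hl : 0 < l) {ls : Fin n → ℕ} (hls : ∀ k, 0 < ls k)
    (α : Fin n → ℕ) : α ∈ indices l ls ↔ dot α (weight l ls) = l := by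
  simp only [indices, Finset.mem_filter, Finset.mem_Iic, and_iff_right_iff_imp]
  intro h k
  have hk : (0 : ℝ) < ls k := by exact_mod_cast hls k
  have hl' : (0 : ℝ) < l := by exact_mod_cast hl
  have h1 : (α k : ℝ) * weight l ls k ≤ l := by
    rw [← h, dot]
    refine Finset.single_le_sum (f := fun j => (α j : ℝ) * weight l ls j) (fun j _ => ?_)
      (Finset.mem_univ k)
    simp only [weight]
    positivity
  have h2 : (α k : ℝ) * ((l : ℝ) / ls k) ≤ l := h1
  rw [← mul_div_assoc, div_le_iff₀ hk, mul_comm] at h2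
  exact_mod_cast le_of_mul_le_mul_left h2 hl'

/-- `(iz)^α` for a multi-index `α` and a real vector `z`. -/
def iPow {n : ℕ} (z : Fin n → ℝ) (α : Fin n → ℕ) : ℂ := ∏ k, (Complex.I * (z k : ℂ)) ^ α k

/-- The symbol `∑_{α·γ = ℓ} (iz)^α A_α` of the family of coefficients `A`. -/
def symbolOf {n m : ℕ} (l : ℕ) (ls : Fin n → ℕ)
    (A : (Fin n → ℕ) → Matrix (Fin m) (Fin m) ℂ) (z : Fin n → ℝ) : Matrix (Fin m) (Fin m) ℂ :=
  ∑ α ∈ indices l ls, iPow z α • A α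

/-- The norm `|M| = (∑ |M i j|²)^{1/2}` of a complex matrix. -/
def frob {m p : ℕ} (M : Matrix (Fin m) (Fin p) ℂ) : ℝ := √(∑ i, ∑ j, ‖M i j‖ ^ 2)

/-- The first order partial derivative `∂f/∂x_k`. -/
def pderiv {n : ℕ} (k : Fin n) (f : (Fin n → ℝ) → ℂ) : (Fin n → ℝ) → ℂ :=
  fun x => lineDeriv ℝ f x (Pi.single k 1)

/-- The partial derivative `∂^β f = ∂₁^{β₁} (∂₂^{β₂} ( ⋯ ∂ₙ^{βₙ} f))`. -/
def mderiv {n : ℕ} (β : Fin n → ℕ) (f : (Fin n → ℝ) → ℂ) : (Fin n → ℝ) → ℂ :=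
  (List.finRange n).foldr (fun k g => (pderiv k)^[β k] g) f

/-- The partial derivative `∂^β u` of a matrix valued function, taken entrywise. -/
def matDeriv {n m p : ℕ} (β : Fin n → ℕ) (u : (Fin n → ℝ) → Matrix (Fin m) (Fin p) ℂ)
    (x : Fin n → ℝ) : Matrix (Fin m) (Fin p) ℂ :=
  Matrix.of fun i j => mderiv β (fun y => u y i j) x

/-- The anisotropic dilation `s^γ x = (s^{γ₁} x₁, …, s^{γₙ} xₙ)`, used for `s > 0`. -/
def dilate {n : ℕ} (γ : Fin n → ℝ) (s : ℝ) (x : Fin n → ℝ) : Fin n → ℝ :=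
  fun k => s ^ γ k * x k

end Semielliptic

open Semielliptic in
/-- A semielliptic operator `∑_{α·γ = ℓ} A_α ∂^α` in `n` real variables, with constant complex
`m × m` matrix coefficients. The values `A α` with `α · γ ≠ ℓ` play no role. -/
structure SemiellipticOperator (n m : ℕ) where
  /-- the order `ℓ` -/
  l : ℕ
  l_pos : 0 < l
  /-- the positive integers `ℓ₁, …, ℓₙ` -/
  ls : Fin n → ℕ
  ls_pos : ∀ k, 0 < ls k
  /-- the coefficients `A_α` -/
  A : (Fin n → ℕ) → Matrix (Fin m) (Fin m) ℂ
  /-- `ℓ` is the maximum of the `|α|` with `A_α ≠ 0` -/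
  order_eq : IsGreatest {d : ℕ | ∃ α ∈ indices l ls, A α ≠ 0 ∧ ∑ k, α k = d} l
  /-- semiellipticity: the symbol is invertible at all nonzero vectors -/
  invertible : ∀ z : Fin n → ℝ, z ≠ 0 → IsUnit (symbolOf l ls A z)

namespace SemiellipticOperator

open Semielliptic

variable {n m : ℕ} (P : SemiellipticOperator n m)

/-- The vector `γ = (ℓ/ℓ₁, …, ℓ/ℓₙ)`. -/
def γ : Fin n → ℝ := weight P.l P.ls

/-- `‖γ‖ = γ₁ + ⋯ + γₙ`. -/
def γnorm : ℝ := ∑ k, P.γ k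

/-- The symbol `L`. -/
def symbol (z : Fin n → ℝ) : Matrix (Fin m) (Fin m) ℂ := symbolOf P.l P.ls P.A z

/-- The action of the operator on functions whose values have `p` columns of length `m`
(`p = 1`: vector functions; `p = m`: square matrix functions). -/
def act {p : ℕ} (u : (Fin n → ℝ) → Matrix (Fin m) (Fin p) ℂ) (x : Fin n → ℝ) :
    Matrix (Fin m) (Fin p) ℂ :=
  ∑ α ∈ indices P.l P.ls, P.A α * matDeriv α u x

/-- `σ(x) = ∑ x_k^{2ℓ_k}`. -/
def σ (x : Fin n → ℝ) : ℝ := ∑ k, x k ^ (2 * P.ls k)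

/-- `ρ(x) = σ(x)^{1/(2ℓ)}`. -/
def ρ (x : Fin n → ℝ) : ℝ := P.σ x ^ (1 / (2 * (P.l : ℝ)))

/-- The integrand `e^{ix·z} σ(z) e^{-tσ(z)} L(z)⁻¹`. -/
def integrand (x : Fin n → ℝ) (t : ℝ) (z : Fin n → ℝ) : Matrix (Fin m) (Fin m) ℂ :=
  (Complex.exp (Complex.I * ((∑ k, x k * z k : ℝ) : ℂ)) * (P.σ z : ℂ) *
    (Real.exp (-(t * P.σ z)) : ℂ)) • (P.symbol z)⁻¹

/-- The integrand `e^{ix·z} (iz)^β σ(z) e^{-tσ(z)} L(z)⁻¹`. -/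
def integrandβ (β : Fin n → ℕ) (x : Fin n → ℝ) (t : ℝ) (z : Fin n → ℝ) :
    Matrix (Fin m) (Fin m) ℂ :=
  (Complex.exp (Complex.I * ((∑ k, x k * z k : ℝ) : ℂ)) * iPow z β * (P.σ z : ℂ) *
    (Real.exp (-(t * P.σ z)) : ℂ)) • (P.symbol z)⁻¹

/-- The inner integral `J_β(x, t)`; integrals of matrix functions are taken entrywise. -/
def Jβ (β : Fin n → ℕ) (x : Fin n → ℝ) (t : ℝ) : Matrix (Fin m) (Fin m) ℂ :=
  Matrix.of fun i j => ∫ z : Fin n → ℝ, P.integrandβ β x t z i j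

/-- `F(x) = (2π)^{-n} ∫_0^∞ ∫ e^{ix·z} σ(z) e^{-tσ(z)} L(z)⁻¹ dz dt`. -/
def F (x : Fin n → ℝ) : Matrix (Fin m) (Fin m) ℂ :=
  ((2 * Real.pi) ^ n)⁻¹ •
    Matrix.of fun i j => ∫ t in Ioi (0 : ℝ), ∫ z : Fin n → ℝ, P.integrand x t z i j

/-- The formal derivative `F_β(x) = (2π)^{-n} ∫_0^∞ J_β(x, t) dt`. -/
def Fβ (β : Fin n → ℕ) (x : Fin n → ℝ) : Matrix (Fin m) (Fin m) ℂ :=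
  ((2 * Real.pi) ^ n)⁻¹ • Matrix.of fun i j => ∫ t in Ioi (0 : ℝ), P.Jβ β x t i j

end SemiellipticOperator

end

/-! Up to the factor (2π)^{-n}, each entry of F_β is the time integral of G(x,t) = ∫ e^{ix·z} h(z)
e^{-tσ(z)} dz, where h is an entry of (iz)^β σ L⁻¹, smooth off the origin and γ-homogeneous of
degree d = β·γ + ℓ. The argument works for all such h with d > 2ℓ - ‖γ‖; for the kernels this
follows from ‖γ‖ > ℓ.

Scaling gives G = O(t^{-(‖γ‖+d)/(2ℓ)}), integrable at infinity exactly because d > 2ℓ - ‖γ‖. Near t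
= 0, if x_k ≠ 0, each integration by parts in z_k improves the power of t by γ_k/(2ℓ), and γ_k ≤ ℓ
leaves room for enough of them before the singularity of h at the origin matters
(`coord_mul_fourierHeat`, `exists_integrable_bound`). The bounds are locally uniform in x ≠ 0, and
∂_k only replaces h by i z_k h, of higher degree, so differentiation under the integral can be
repeated indefinitely (`hasFDerivAt_timeIntegral`). Homogeneity comes from a change of variables in
z and t, and the estimate on F_β from homogeneity and compactness of {σ = 1}.

Applying the operator cancels L⁻¹ and leaves a multiple of ∫_0^∞ ∫ e^{ix·z} σ e^{-tσ} dz dt times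
the identity. The integrand is -∂_t of K(t) = ∫ e^{ix·z} e^{-tσ} dz, and K tends to 0 at both ends
when x ≠ 0 (`timeIntegral_σ`). -/

noncomputable section

/-! ### Anisotropically homogeneous functions -/

namespace Semielliptic

variable {n : ℕ}

/-- `h` is smooth away from the origin and homogeneous of degree `d` under the dilations
`z ↦ s^γ z`. -/
structure IsHomog (γ : Fin n → ℝ) (d : ℝ) (h : (Fin n → ℝ) → ℂ) : Prop where
  smooth : ContDiffOn ℝ ∞ h {0}ᶜ
  homog : ∀ s : ℝ, 0 < s → ∀ z : Fin n → ℝ, z ≠ 0 → h (dilate γ s z) = ((s ^ d : ℝ) : ℂ) * h z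

theorem dilate_dilate_inv (γ : Fin n → ℝ) {s : ℝ} (hs : 0 < s) (x : Fin n → ℝ) :
    dilate γ s (dilate γ s⁻¹ x) = x := by
  funext k
  have := Real.rpow_pos_of_pos hs (γ k)
  simp only [dilate, Real.inv_rpow hs.le]
  field_simp

theorem dilate_inv_dilate (γ : Fin n → ℝ) {s : ℝ} (hs : 0 < s) (x : Fin n → ℝ) :
    dilate γ s⁻¹ (dilate γ s x) = x := by
  simpa using dilate_dilate_inv γ (inv_pos.2 hs) x

theorem dilate_zero (γ : Fin n → ℝ) (s : ℝ) : dilate γ s 0 = 0 := by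
  funext k; simp [dilate]

theorem dilate_ne_zero (γ : Fin n → ℝ) {s : ℝ} (hs : 0 < s) {x : Fin n → ℝ} (hx : x ≠ 0) :
    dilate γ s x ≠ 0 := by
  intro h
  apply hx
  rw [← dilate_inv_dilate γ hs x, h, dilate_zero]

theorem isOpen_compl_zero : IsOpen ({0}ᶜ : Set (Fin n → ℝ)) := isOpen_compl_singleton

namespace IsHomog

variable {γ : Fin n → ℝ} {d d' : ℝ} {h h' : (Fin n → ℝ) → ℂ}

theorem mul (H : IsHomog γ d h) (H' : IsHomog γ d' h') :
    IsHomog γ (d + d') (fun z => h z * h' z) where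
  smooth := H.smooth.mul H'.smooth
  homog s hs z hz := by
    rw [H.homog s hs z hz, H'.homog s hs z hz, Real.rpow_add hs]
    push_cast
    ring

theorem const (γ : Fin n → ℝ) (c : ℂ) : IsHomog γ 0 (fun _ => c) where
  smooth := contDiffOn_const
  homog s hs z hz := by simp

theorem const_mul (H : IsHomog γ d h) (c : ℂ) : IsHomog γ d (fun z => c * h z) := by
  simpa using (const γ c).mul H

theorem coord (γ : Fin n → ℝ) (k : Fin n) : IsHomog γ (γ k) (fun z => (z k : ℂ)) where
  smooth := (Complex.ofRealCLM.contDiff.comp (contDiff_apply ℝ ℝ k)).contDiffOn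
  homog s hs z hz := by simp [dilate]

theorem pow (H : IsHomog γ d h) (a : ℕ) : IsHomog γ (a * d) (fun z => h z ^ a) where
  smooth := H.smooth.pow a
  homog s hs z hz := by
    rw [H.homog s hs z hz, mul_comm (a : ℝ) d, Real.rpow_mul hs.le, Real.rpow_natCast, mul_pow]
    push_cast
    rfl

theorem prod {ι : Type*} (s : Finset ι) {d : ι → ℝ} {h : ι → (Fin n → ℝ) → ℂ}
    (H : ∀ i ∈ s, IsHomog γ (d i) (h i)) :
    IsHomog γ (∑ i ∈ s, d i) (fun z => ∏ i ∈ s, h i z) := by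
  classical
  induction s using Finset.induction_on with
  | empty => simpa using const γ 1
  | insert i s hi ih =>
    simp only [Finset.prod_insert hi, Finset.sum_insert hi]
    exact (H i (by simp)).mul (ih fun j hj => H j (by simp [hj]))

theorem iPow (γ : Fin n → ℝ) (β : Fin n → ℕ) : IsHomog γ (dot β γ) (fun z => iPow z β) :=
  prod Finset.univ fun k _ => ((coord γ k).const_mul Complex.I).pow (β k)

theorem differentiableAt (H : IsHomog γ d h) {z : Fin n → ℝ} (hz : z ≠ 0) :
    DifferentiableAt ℝ h z :=
  (H.smooth.contDiffAt (isOpen_compl_zero.mem_nhds hz)).differentiableAt (by simp)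

theorem hasLineDerivAt (H : IsHomog γ d h) {z : Fin n → ℝ} (hz : z ≠ 0) (k : Fin n) :
    HasLineDerivAt ℝ h (pderiv k h z) z (Pi.single k 1) :=
  (H.differentiableAt hz).lineDifferentiableAt.hasLineDerivAt

/-- The derivative at t = 0 of h(s^γ (z + t e_k)) is computed twice: by the chain rule, which yields
a factor s^{γ_k}, and by homogeneity, which yields s^d. -/
theorem pderiv (H : IsHomog γ d h) (k : Fin n) : IsHomog γ (d - γ k) (pderiv k h) where
  smooth := by
    have h1 : ContDiffOn ℝ ∞ (fun z => fderiv ℝ h z (Pi.single k 1)) {0}ᶜ :=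
      (H.smooth.fderiv_of_isOpen isOpen_compl_zero (by simp)).clm_apply contDiffOn_const
    refine h1.congr fun z hz => ?_
    exact (H.differentiableAt hz).lineDeriv_eq_fderiv
  homog s hs z hz := by
    have hp := Real.rpow_pos_of_pos hs (γ k)
    have h0 := H.hasLineDerivAt hz k
    have h1 := H.hasLineDerivAt (dilate_ne_zero γ hs hz) k
    have hline : ∀ t : ℝ, dilate γ s z + (s ^ γ k * t) • Pi.single k (1 : ℝ)
        = dilate γ s (z + t • Pi.single k (1 : ℝ)) := by
      intro t
      funext j
      by_cases hj : j = k
      · subst hj; simp [dilate]; ring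
      · simp [dilate, hj]
    have h2 : HasDerivAt (fun t : ℝ => h (dilate γ s (z + t • Pi.single k (1 : ℝ))))
        (((s ^ γ k : ℝ) : ℂ) * Semielliptic.pderiv k h (dilate γ s z)) 0 := by
      have h3 : HasDerivAt (fun t : ℝ => s ^ γ k * t) (s ^ γ k) 0 := by
        simpa using (hasDerivAt_id (0 : ℝ)).const_mul (s ^ γ k)
      have h1' : HasDerivAt (fun t : ℝ => h (dilate γ s z + t • Pi.single k (1 : ℝ)))
        (Semielliptic.pderiv k h (dilate γ s z)) (s ^ γ k * 0) := by
        rw [mul_zero]; exact h1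
      have h4 := h1'.scomp (0 : ℝ) h3
      simp only [Function.comp_def, hline, Complex.real_smul] at h4
      exact h4
    have h5 : HasDerivAt (fun t : ℝ => h (dilate γ s (z + t • Pi.single k (1 : ℝ))))
        (((s ^ d : ℝ) : ℂ) * Semielliptic.pderiv k h z) 0 := by
      refine (HasDerivAt.const_mul ((s ^ d : ℝ) : ℂ) h0).congr_of_eventuallyEq ?_
      have hc : Continuous (fun t : ℝ => z + t • Pi.single k (1 : ℝ)) := by fun_prop
      have hz' : z + (0 : ℝ) • Pi.single k (1 : ℝ) ∈ ({0}ᶜ : Set (Fin n → ℝ)) := by simpa using hz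
      filter_upwards [hc.continuousAt.preimage_mem_nhds (isOpen_compl_zero.mem_nhds hz')] with t ht
      exact H.homog s hs _ ht
    have h6 := h2.unique h5
    rw [Real.rpow_sub hs]
    have hp' : ((s ^ γ k : ℝ) : ℂ) ≠ 0 := by exact_mod_cast hp.ne'
    push_cast
    field_simp
    rw [mul_comm]
    exact h6

end IsHomog

end Semielliptic

/-! ### Homogeneity of σ and of the inverse symbol -/

namespace SemiellipticOperator

open Semielliptic

variable {n m : ℕ} (P : SemiellipticOperator n m)

theorem l_pos' : (0 : ℝ) < P.l := by exact_mod_cast P.l_pos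

theorem ls_pos' (k : Fin n) : (0 : ℝ) < P.ls k := by exact_mod_cast P.ls_pos k

theorem γ_pos (k : Fin n) : 0 < P.γ k := div_pos P.l_pos' (P.ls_pos' k)

theorem γ_mul_ls (k : Fin n) : P.γ k * P.ls k = P.l := div_mul_cancel₀ _ (P.ls_pos' k).ne'

theorem γ_le (k : Fin n) : P.γ k ≤ P.l := by
  have h1 : (1 : ℝ) ≤ P.ls k := by exact_mod_cast P.ls_pos k
  exact div_le_self P.l_pos'.le h1

theorem σ_nonneg (z : Fin n → ℝ) : 0 ≤ P.σ z :=
  Finset.sum_nonneg fun k _ => by rw [pow_mul]; positivity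

theorem pow_le_σ (z : Fin n → ℝ) (k : Fin n) : z k ^ (2 * P.ls k) ≤ P.σ z :=
  Finset.single_le_sum (f := fun k => z k ^ (2 * P.ls k))
    (fun k _ => by rw [pow_mul]; positivity) (Finset.mem_univ k)

theorem σ_pos {z : Fin n → ℝ} (hz : z ≠ 0) : 0 < P.σ z := by
  obtain ⟨k, hk⟩ := Function.ne_iff.1 hz
  refine lt_of_lt_of_le ?_ (P.pow_le_σ z k)
  rw [pow_mul]
  have : z k ≠ 0 := hk
  positivity

theorem contDiff_σ : ContDiff ℝ ∞ P.σ := by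
  unfold SemiellipticOperator.σ
  fun_prop

theorem continuous_σ : Continuous P.σ := P.contDiff_σ.continuous

theorem σ_dilate {s : ℝ} (hs : 0 < s) (z : Fin n → ℝ) :
    P.σ (dilate P.γ s z) = s ^ (2 * (P.l : ℝ)) * P.σ z := by
  simp only [σ, dilate, Finset.mul_sum, mul_pow]
  refine Finset.sum_congr rfl fun k _ => ?_
  rw [← Real.rpow_natCast (s ^ P.γ k), ← Real.rpow_mul hs.le, ← P.γ_mul_ls k]
  congr 2
  push_cast
  ring

theorem isHomog_σ : IsHomog P.γ (2 * P.l) (fun z => (P.σ z : ℂ)) where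
  smooth := (Complex.ofRealCLM.contDiff.comp P.contDiff_σ).contDiffOn
  homog s hs z _ := by rw [P.σ_dilate hs]; push_cast; rfl

theorem ρ_pos {z : Fin n → ℝ} (hz : z ≠ 0) : 0 < P.ρ z := Real.rpow_pos_of_pos (P.σ_pos hz) _

theorem ρ_rpow (z : Fin n → ℝ) (d : ℝ) : P.ρ z ^ d = P.σ z ^ (d / (2 * P.l)) := by
  rw [ρ, ← Real.rpow_mul (P.σ_nonneg z)]
  congr 1
  ring

theorem σ_dilate_ρ_inv {z : Fin n → ℝ} (hz : z ≠ 0) : P.σ (dilate P.γ (P.ρ z)⁻¹ z) = 1 := by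
  have hl := P.l_pos'
  rw [P.σ_dilate (inv_pos.2 (P.ρ_pos hz)), Real.inv_rpow (P.ρ_pos hz).le, P.ρ_rpow,
    div_self (by positivity), Real.rpow_one, inv_mul_cancel₀ (P.σ_pos hz).ne']

theorem isCompact_sphere : IsCompact {z : Fin n → ℝ | P.σ z = 1} := by
  refine Metric.isCompact_of_isClosed_isBounded (isClosed_eq P.continuous_σ continuous_const) ?_
  refine (Metric.isBounded_closedBall (x := (0 : Fin n → ℝ)) (r := 1)).subset fun z hz => ?_
  rw [mem_closedBall_zero_iff, pi_norm_le_iff_of_nonneg zero_le_one]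
  intro k
  have h1 := P.pow_le_σ z k
  rw [show P.σ z = 1 from hz, ← Even.pow_abs (even_two_mul _)] at h1
  have := P.ls_pos k
  exact (pow_le_one_iff_of_nonneg (abs_nonneg _) (by omega)).1 h1

variable {P} in
/-- A homogeneous function of degree `d` is bounded by a multiple of `ρ^d`. -/
theorem exists_norm_le {d : ℝ} {h : (Fin n → ℝ) → ℂ} (H : IsHomog P.γ d h) :
    ∃ C : ℝ, 0 ≤ C ∧ ∀ z, z ≠ 0 → ‖h z‖ ≤ C * P.ρ z ^ d := by
  have hne : ∀ z : Fin n → ℝ, P.σ z = 1 → z ≠ 0 := by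
    rintro z hz rfl
    have : P.σ (0 : Fin n → ℝ) = 0 := by
      simp only [σ, Pi.zero_apply]
      exact Finset.sum_eq_zero fun k _ => zero_pow (by have := P.ls_pos k; omega)
    rw [this] at hz
    exact zero_ne_one hz
  obtain ⟨C, hC⟩ := P.isCompact_sphere.exists_bound_of_continuousOn
    (H.smooth.continuousOn.mono fun z hz => hne z hz)
  refine ⟨max C 0, le_max_right _ _, fun z hz => ?_⟩
  have hρ := P.ρ_pos hz
  have h1 := hC _ (P.σ_dilate_ρ_inv hz)
  -- Every z ≠ 0 is the dilation by ρ(z) of a point of the compact set {σ = 1}.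
  have h2 := H.homog _ hρ (dilate P.γ (P.ρ z)⁻¹ z) (dilate_ne_zero _ (inv_pos.2 hρ) hz)
  rw [dilate_dilate_inv _ hρ] at h2
  rw [h2, norm_mul, Complex.norm_real, Real.norm_of_nonneg (by positivity), mul_comm]
  gcongr
  exact h1.trans (le_max_left _ _)

theorem contDiff_symbol_apply (i j : Fin m) : ContDiff ℝ ∞ (fun z => P.symbol z i j) := by
  simp only [symbol, symbolOf, Matrix.sum_apply, Matrix.smul_apply, iPow, smul_eq_mul]
  have : ∀ k : Fin n, ContDiff ℝ ∞ fun z : Fin n → ℝ => (z k : ℂ) := fun k =>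
    Complex.ofRealCLM.contDiff.comp (contDiff_apply ℝ ℝ k)
  fun_prop

theorem contDiff_det {M : (Fin n → ℝ) → Matrix (Fin m) (Fin m) ℂ}
    (hM : ∀ i j, ContDiff ℝ ∞ fun z => M z i j) : ContDiff ℝ ∞ fun z => (M z).det := by
  simp only [Matrix.det_apply]
  refine ContDiff.sum fun τ _ => ContDiff.const_smul _ ?_
  exact contDiff_prod fun i _ => hM _ _

theorem symbol_dilate {s : ℝ} (hs : 0 < s) {z : Fin n → ℝ} (hz : z ≠ 0) :
    P.symbol (dilate P.γ s z) = ((s ^ (P.l : ℝ) : ℝ) : ℂ) • P.symbol z := by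
  simp only [symbol, symbolOf, Finset.smul_sum, smul_smul]
  refine Finset.sum_congr rfl fun α hα => ?_
  rw [(IsHomog.iPow P.γ α).homog s hs z hz,
    show dot α P.γ = P.l from (mem_indices P.l_pos P.ls_pos α).1 hα]

theorem isUnit_det {z : Fin n → ℝ} (hz : z ≠ 0) : IsUnit (P.symbol z).det :=
  (Matrix.isUnit_iff_isUnit_det _).1 (P.invertible z hz)

/-- Smoothness is Cramer's rule: the adjugate is polynomial and the determinant does not vanish off
the origin. The degree is -ℓ because L scales by s^ℓ. -/
theorem isHomog_symbol_inv (i j : Fin m) :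
    IsHomog P.γ (-P.l) (fun z => (P.symbol z)⁻¹ i j) where
  smooth := by
    simp only [Matrix.inv_def, Ring.inverse_eq_inv', Matrix.smul_apply, smul_eq_mul,
      Matrix.adjugate_apply]
    refine ContDiffOn.mul ?_ ?_
    · exact (contDiff_det P.contDiff_symbol_apply).contDiffOn.inv
        fun z hz => (P.isUnit_det hz).ne_zero
    · refine (contDiff_det fun a b => ?_).contDiffOn
      by_cases ha : a = j
      · subst ha; simpa using contDiff_const
      · simpa [Matrix.updateRow_ne ha] using P.contDiff_symbol_apply a b
  homog s hs z hz := by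
    have hp : ((s ^ (P.l : ℝ) : ℝ) : ℂ) ≠ 0 := by
      exact Complex.ofReal_ne_zero.2 (Real.rpow_pos_of_pos hs _).ne'
    have := Matrix.inv_smul' (P.symbol z) (Units.mk0 _ hp) (P.isUnit_det hz)
    simp only [Units.smul_mk0] at this
    rw [P.symbol_dilate hs hz, this, Real.rpow_neg hs.le]
    simp [Units.smul_def]

end SemiellipticOperator

/-! ### Integrability of homogeneous functions against e^{-tσ} -/

namespace Semielliptic

variable {n : ℕ}

theorem ae_ne_zero (n : ℕ) : ∀ᵐ z : Fin n → ℝ, ∀ k, z k ≠ 0 :=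
  ae_all_iff.2 fun k => Measure.ae_eval_ne (fun _ => volume) k 0

theorem ae_ne (n : ℕ) [Nontrivial (Fin n)] : ∀ᵐ z : Fin n → ℝ, z ≠ 0 := by
  obtain ⟨k, -⟩ := exists_pair_ne (Fin n)
  filter_upwards [ae_ne_zero n] with z hz h
  exact hz k (by rw [h]; rfl)

theorem integrable_abs_rpow_mul_exp {p b : ℝ} (hp : -1 < p) (hb : 0 < b) {N : ℕ} (hN : 0 < N) :
    Integrable (fun x : ℝ => |x| ^ p * Real.exp (-(b * x ^ (2 * N)))) := by
  have h1 : IntegrableOn (fun x : ℝ => x ^ p * Real.exp (-(b * x ^ (2 * N)))) (Ioi 0) := by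
    have := integrableOn_rpow_mul_exp_neg_mul_rpow (p := (2 * N : ℕ)) hp
      (by exact_mod_cast (by omega : 0 < 2 * N)) hb
    refine this.congr_fun (fun x _ => ?_) measurableSet_Ioi
    simp only [Real.rpow_natCast, neg_mul]
  have h2 : IntegrableOn (fun x : ℝ => |x| ^ p * Real.exp (-(b * x ^ (2 * N)))) (Ioi 0) :=
    h1.congr_fun (fun x hx => by simp only [abs_of_pos (mem_Ioi.1 hx)]) measurableSet_Ioi
  rw [← integrableOn_univ, ← Iio_union_Ici (a := (0 : ℝ)), integrableOn_union,
    integrableOn_Ici_iff_integrableOn_Ioi]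
  refine ⟨?_, h2⟩
  rw [← (Measure.measurePreserving_neg (volume : Measure ℝ)).integrableOn_comp_preimage
      (Homeomorph.neg ℝ).measurableEmbedding]
  simpa only [Function.comp_def, neg_preimage, neg_Iio, neg_zero, abs_neg,
    (even_two_mul N).neg_pow] using h2

theorem exists_rpow_mul_exp_le {q t : ℝ} (hq : 0 ≤ q) (ht : 0 < t) :
    ∃ C : ℝ, ∀ u : ℝ, 0 ≤ u → u ^ q * Real.exp (-(t * u)) ≤ C := by
  obtain ⟨N, hN⟩ := exists_nat_ge q
  refine ⟨1 + N.factorial / t ^ N, fun u hu => ?_⟩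
  have h1 : u ^ q ≤ 1 + u ^ N := by
    rcases le_total u 1 with h | h
    · exact (Real.rpow_le_one hu h hq).trans (le_add_of_nonneg_right (by positivity))
    · refine (Real.rpow_le_rpow_of_exponent_le h hN).trans ?_
      rw [Real.rpow_natCast]
      linarith
  have h2 : u ^ N ≤ N.factorial / t ^ N * Real.exp (t * u) := by
    have := Real.pow_div_factorial_le_exp (t * u) (by positivity) N
    rw [div_le_iff₀ (by positivity), mul_pow] at this
    rw [div_mul_eq_mul_div, le_div_iff₀ (by positivity)]
    linarith
  have h3 : 1 ≤ Real.exp (t * u) := Real.one_le_exp (by positivity)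
  rw [Real.exp_neg, ← div_eq_mul_inv, div_le_iff₀ (Real.exp_pos _)]
  linarith

end Semielliptic

namespace SemiellipticOperator

open Semielliptic

variable {n m : ℕ} (P : SemiellipticOperator n m)

theorem exp_neg_σ (t : ℝ) (z : Fin n → ℝ) :
    Real.exp (-(t * P.σ z)) = ∏ k, Real.exp (-(t * z k ^ (2 * P.ls k))) := by
  rw [← Real.exp_sum, σ, Finset.mul_sum, Finset.sum_neg_distrib]

theorem γnorm_pos [Nontrivial (Fin n)] : 0 < P.γnorm :=
  Finset.sum_pos (fun k _ => P.γ_pos k) (by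
    obtain ⟨k, -⟩ := exists_pair_ne (Fin n)
    exact ⟨k, Finset.mem_univ k⟩)

theorem continuous_exp_σ (t : ℝ) : Continuous fun z => Real.exp (-(t * P.σ z)) := by
  have := P.continuous_σ
  fun_prop

theorem measurable_ρ_rpow (d : ℝ) : Measurable fun z => P.ρ z ^ d := by
  unfold ρ
  exact (P.continuous_σ.measurable.pow_const _).pow_const _

/-- The exponent of σ is split into shares proportional to γ_k, and σ ≥ |z_k|^{2ℓ_k} is used in the
k-th share. As γ_k ℓ_k = ℓ, every coordinate receives the same exponent d/‖γ‖, which exceeds -1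
exactly when d > -‖γ‖; integrability then reduces to one variable. -/
theorem ρ_rpow_le_prod [Nontrivial (Fin n)] {d : ℝ} (hd : d ≤ 0) {z : Fin n → ℝ}
    (hz : ∀ k, z k ≠ 0) : P.ρ z ^ d ≤ ∏ k, |z k| ^ (d / P.γnorm) := by
  have hl := P.l_pos'
  have hγ := P.γnorm_pos
  have hz0 : z ≠ 0 := by
    obtain ⟨k, -⟩ := exists_pair_ne (Fin n)
    rintro rfl
    exact hz k rfl
  have h1 : d / (2 * P.l) = ∑ k, d * P.γ k / (2 * P.l * P.γnorm) := by
    rw [← Finset.sum_div, ← Finset.mul_sum, show ∑ k, P.γ k = P.γnorm from rfl]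
    field_simp
  rw [P.ρ_rpow, h1, Real.rpow_sum_of_pos (P.σ_pos hz0)]
  refine Finset.prod_le_prod (fun k _ => Real.rpow_nonneg (P.σ_nonneg z) _) fun k _ => ?_
  have hpos : 0 < |z k| ^ (2 * P.ls k) := pow_pos (abs_pos.2 (hz k)) _
  have h2 : |z k| ^ (2 * P.ls k) ≤ P.σ z := by
    rw [(even_two_mul _).pow_abs]
    exact P.pow_le_σ z k
  refine (Real.rpow_le_rpow_of_nonpos hpos h2 ?_).trans_eq ?_
  · exact div_nonpos_of_nonpos_of_nonneg (mul_nonpos_of_nonpos_of_nonneg hd (P.γ_pos k).le)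
      (by positivity)
  · rw [← Real.rpow_natCast, ← Real.rpow_mul (abs_nonneg _), ← P.γ_mul_ls k]
    have := P.γ_pos k
    have := P.ls_pos' k
    congr 1
    push_cast
    field_simp

theorem integrable_ρ_rpow_mul_exp [Nontrivial (Fin n)] {d t : ℝ} (hd : -P.γnorm < d)
    (ht : 0 < t) : Integrable fun z : Fin n → ℝ => P.ρ z ^ d * Real.exp (-(t * P.σ z)) := by
  have hγ := P.γnorm_pos
  have hl := P.l_pos'
  have hmeas : ∀ d t : ℝ, AEStronglyMeasurable
      (fun z : Fin n → ℝ => P.ρ z ^ d * Real.exp (-(t * P.σ z))) volume := fun d t =>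
    ((P.measurable_ρ_rpow d).mul (P.continuous_exp_σ t).measurable).aestronglyMeasurable
  have hnonneg : ∀ (d : ℝ) (z : Fin n → ℝ), 0 ≤ P.ρ z ^ d := fun d z => by
    rw [P.ρ_rpow]; exact Real.rpow_nonneg (P.σ_nonneg z) _
  have key : ∀ d t : ℝ, -P.γnorm < d → d ≤ 0 → 0 < t →
      Integrable fun z : Fin n → ℝ => P.ρ z ^ d * Real.exp (-(t * P.σ z)) := by
    intro d t hd hd0 ht
    have h1 : Integrable (fun z : Fin n → ℝ =>
        ∏ k, |z k| ^ (d / P.γnorm) * Real.exp (-(t * z k ^ (2 * P.ls k)))) :=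
      Integrable.fintype_prod (f := fun k (x : ℝ) =>
        |x| ^ (d / P.γnorm) * Real.exp (-(t * x ^ (2 * P.ls k)))) fun k =>
          integrable_abs_rpow_mul_exp (by rw [lt_div_iff₀ hγ]; linarith) ht (P.ls_pos k)
    refine h1.mono' (hmeas d t) ?_
    filter_upwards [ae_ne_zero n] with z hz
    rw [Real.norm_of_nonneg (mul_nonneg (hnonneg d z) (Real.exp_pos _).le), P.exp_neg_σ,
      Finset.prod_mul_distrib]
    gcongr
    exact P.ρ_rpow_le_prod hd0 hz
  rcases le_total d 0 with hd0 | hd0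
  · exact key d t hd hd0 ht
  -- For d ≥ 0, half of the exponential absorbs the power of ρ, which reduces to d = 0.
  · obtain ⟨C, hC⟩ := exists_rpow_mul_exp_le (q := d / (2 * P.l)) (t := t / 2) (by positivity)
      (by positivity)
    refine ((key 0 (t / 2) (by linarith) le_rfl (by positivity)).const_mul C).mono' (hmeas d t) ?_
    refine ae_of_all _ fun z => ?_
    rw [Real.norm_of_nonneg (mul_nonneg (hnonneg d z) (Real.exp_pos _).le), P.ρ_rpow,
      Real.rpow_zero, one_mul,
      show -(t * P.σ z) = -(t / 2 * P.σ z) + -(t / 2 * P.σ z) by ring, Real.exp_add, ← mul_assoc]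
    gcongr
    exact hC _ (P.σ_nonneg z)

theorem _root_.Semielliptic.IsHomog.aestronglyMeasurable [Nontrivial (Fin n)] {γ : Fin n → ℝ}
    {d : ℝ} {h : (Fin n → ℝ) → ℂ} (H : IsHomog γ d h) : AEStronglyMeasurable h volume := by
  have h1 := H.smooth.continuousOn.aestronglyMeasurable (μ := volume) isOpen_compl_zero.measurableSet
  rwa [Measure.restrict_eq_self_of_ae_mem] at h1
  filter_upwards [ae_ne n] with z hz
  exact hz

variable {P} in
theorem integrable_mul_exp [Nontrivial (Fin n)] {d t : ℝ} {h : (Fin n → ℝ) → ℂ}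
    (H : IsHomog P.γ d h) (hd : -P.γnorm < d) (ht : 0 < t) :
    Integrable fun z => h z * (Real.exp (-(t * P.σ z)) : ℂ) := by
  obtain ⟨C, -, hC⟩ := exists_norm_le H
  refine ((P.integrable_ρ_rpow_mul_exp hd ht).const_mul C).mono'
    (H.aestronglyMeasurable.mul
      (Complex.continuous_ofReal.comp (P.continuous_exp_σ t)).aestronglyMeasurable) ?_
  filter_upwards [ae_ne n] with z hz
  rw [norm_mul, Complex.norm_real, Real.norm_of_nonneg (Real.exp_pos _).le, ← mul_assoc]
  gcongr
  exact hC z hz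

/-! ### The Fourier integral and its scaling -/

/-- The oscillating factor `e^{ix·z}`. -/
def phase (x z : Fin n → ℝ) : ℂ := Complex.exp (Complex.I * ((∑ k, x k * z k : ℝ) : ℂ))

theorem norm_phase (x z : Fin n → ℝ) : ‖phase x z‖ = 1 := by
  rw [phase, mul_comm, Complex.norm_exp_ofReal_mul_I]

theorem continuous_phase (x : Fin n → ℝ) : Continuous (phase x) := by
  unfold phase
  fun_prop

/-- The Fourier integral `∫ e^{ix·z} h(z) e^{-tσ(z)} dz`. -/
def fourierHeat (h : (Fin n → ℝ) → ℂ) (x : Fin n → ℝ) (t : ℝ) : ℂ :=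
  ∫ z : Fin n → ℝ, phase x z * (h z * (Real.exp (-(t * P.σ z)) : ℂ))

theorem integrable_phase_mul {g : (Fin n → ℝ) → ℂ} (hg : Integrable g) (x : Fin n → ℝ) :
    Integrable fun z => phase x z * g z := by
  refine hg.bdd_mul (c := 1) (continuous_phase x).aestronglyMeasurable (ae_of_all _ fun z => ?_)
  exact (norm_phase x z).le

theorem integral_comp_dilate {s : ℝ} (hs : 0 < s) (g : (Fin n → ℝ) → ℂ) :
    ∫ z, g (dilate P.γ s z) = ((s ^ (-P.γnorm) : ℝ) : ℂ) * ∫ z, g z := by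
  have hdet : (Matrix.diagonal fun k => s ^ P.γ k).det = s ^ P.γnorm := by
    rw [Matrix.det_diagonal, γnorm, Real.rpow_sum_of_pos hs]
  have hpos : 0 < s ^ P.γnorm := Real.rpow_pos_of_pos hs _
  have h1 := Real.smul_map_diagonal_volume_pi (D := fun k => s ^ P.γ k) (by rw [hdet]; positivity)
  have hfun : ⇑(Matrix.toLin' (Matrix.diagonal fun k => s ^ P.γ k)) = dilate P.γ s := by
    funext z k
    simp [dilate, Matrix.mulVec_diagonal]
  have hemb : MeasurableEmbedding (dilate P.γ s) := by
    have hc : ∀ s : ℝ, Measurable (dilate P.γ s) := fun s => by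
      unfold dilate
      fun_prop
    let e : (Fin n → ℝ) ≃ᵐ (Fin n → ℝ) :=
      { toFun := dilate P.γ s
        invFun := dilate P.γ s⁻¹
        left_inv := dilate_inv_dilate P.γ hs
        right_inv := dilate_dilate_inv P.γ hs
        measurable_toFun := hc s
        measurable_invFun := hc s⁻¹ }
    exact e.measurableEmbedding
  rw [hfun, hdet, abs_of_pos hpos] at h1
  conv_rhs => rw [← h1]
  rw [integral_smul_measure, hemb.integral_map, ENNReal.toReal_ofReal hpos.le, Complex.real_smul,
    ← mul_assoc, ← Complex.ofReal_mul, ← Real.rpow_add hs, neg_add_cancel, Real.rpow_zero]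
  simp

variable {P} in
-- Substituting s^γ z for z moves the dilation from x to σ, and σ has degree 2ℓ, so it is absorbed
-- into the time. The identity needs no convergence.
theorem fourierHeat_dilate [Nontrivial (Fin n)] {d : ℝ} {h : (Fin n → ℝ) → ℂ}
    (H : IsHomog P.γ d h) {s : ℝ} (hs : 0 < s) (x : Fin n → ℝ) (t : ℝ) :
    P.fourierHeat h (dilate P.γ s x) t =
      ((s ^ (-P.γnorm - d) : ℝ) : ℂ) * P.fourierHeat h x (s ^ (-(2 * (P.l : ℝ))) * t) := by
  have h1 := P.integral_comp_dilate hs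
    fun z => phase x z * (h z * (Real.exp (-(s ^ (-(2 * (P.l : ℝ))) * t * P.σ z)) : ℂ))
  have h2 : ∀ᵐ z : Fin n → ℝ, phase x (dilate P.γ s z) * (h (dilate P.γ s z) *
      (Real.exp (-(s ^ (-(2 * (P.l : ℝ))) * t * P.σ (dilate P.γ s z))) : ℂ)) =
      ((s ^ d : ℝ) : ℂ) * (phase (dilate P.γ s x) z * (h z * (Real.exp (-(t * P.σ z)) : ℂ))) := by
    filter_upwards [ae_ne n] with z hz
    have e1 : phase x (dilate P.γ s z) = phase (dilate P.γ s x) z := by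
      simp only [phase, dilate]
      congr 3
      exact Finset.sum_congr rfl fun k _ => by ring
    have e2 : s ^ (-(2 * (P.l : ℝ))) * t * (s ^ (2 * (P.l : ℝ)) * P.σ z) = t * P.σ z := by
      rw [Real.rpow_neg hs.le]
      have := Real.rpow_pos_of_pos hs (2 * (P.l : ℝ))
      field_simp
    rw [e1, H.homog s hs z hz, P.σ_dilate hs, e2]
    ring
  rw [integral_congr_ae h2, integral_const_mul] at h1
  have hd : ((s ^ d : ℝ) : ℂ) ≠ 0 := Complex.ofReal_ne_zero.2 (Real.rpow_pos_of_pos hs _).ne'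
  rw [fourierHeat, fourierHeat, Real.rpow_sub hs, Complex.ofReal_div, div_mul_eq_mul_div,
    eq_div_iff hd, mul_comm]
  exact h1

end SemiellipticOperator

/-! ### Integration by parts and decay in time -/

namespace SemiellipticOperator

open Semielliptic

variable {n m : ℕ} (P : SemiellipticOperator n m)

theorem hasLineDerivAt_phase (x z : Fin n → ℝ) (k : Fin n) :
    HasLineDerivAt ℝ (phase x) (Complex.I * x k * phase x z) z (Pi.single k 1) := by
  have h1 : ∀ t : ℝ, phase x (z + t • Pi.single k (1 : ℝ)) =
      phase x z * Complex.exp (Complex.I * x k * t) := by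
    intro t
    rw [phase, phase, ← Complex.exp_add]
    congr 1
    simp only [Pi.add_apply, Pi.smul_apply, smul_eq_mul, mul_add, Finset.sum_add_distrib,
      Pi.single_apply, mul_ite, mul_one, mul_zero, Finset.sum_ite_eq', Finset.mem_univ, if_true]
    push_cast
    ring
  have h2 : HasDerivAt (fun t : ℝ => Complex.exp (Complex.I * x k * t))
      (Complex.I * x k) 0 := by
    have := ((hasDerivAt_id (0 : ℝ)).ofReal_comp.const_mul (Complex.I * x k)).cexp
    simpa using this
  have h3 := h2.const_mul (phase x z)
  simp only [HasLineDerivAt, h1]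
  rwa [mul_comm (phase x z)] at h3

/-- The complex valued derivative `∂σ/∂z_k`. -/
def dσ (k : Fin n) : (Fin n → ℝ) → ℂ := pderiv k fun z => (P.σ z : ℂ)

theorem isHomog_dσ (k : Fin n) : IsHomog P.γ (2 * P.l - P.γ k) (P.dσ k) := P.isHomog_σ.pderiv k

variable {P} in
theorem hasLineDerivAt_mul_exp {d : ℝ} {h : (Fin n → ℝ) → ℂ} (H : IsHomog P.γ d h) (t : ℝ)
    {z : Fin n → ℝ} (hz : z ≠ 0) (k : Fin n) :
    HasLineDerivAt ℝ (fun z => h z * (Real.exp (-(t * P.σ z)) : ℂ))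
      (pderiv k h z * (Real.exp (-(t * P.σ z)) : ℂ) -
        t * (h z * P.dσ k z * (Real.exp (-(t * P.σ z)) : ℂ))) z (Pi.single k 1) := by
  have h1 := H.hasLineDerivAt hz k
  have h2 := P.isHomog_σ.hasLineDerivAt hz k
  unfold HasLineDerivAt at h1 h2 ⊢
  have h3 := h1.mul ((h2.const_mul (t : ℂ)).neg.cexp)
  simp only [Pi.neg_apply, zero_smul, add_zero] at h3
  push_cast
  refine h3.congr_deriv ?_
  rw [dσ]
  ring

variable {P} in
/-- Integration by parts in the `k`-th variable. The singularity of `h` at the origin is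
harmless since almost all lines parallel to the `k`-th axis avoid it. -/
theorem coord_mul_fourierHeat [Nontrivial (Fin n)] {d t : ℝ} {h : (Fin n → ℝ) → ℂ}
    (H : IsHomog P.γ d h) (k : Fin n) (hd : P.γ k - P.γnorm < d) (ht : 0 < t) (x : Fin n → ℝ) :
    Complex.I * x k * P.fourierHeat h x t =
      t * P.fourierHeat (fun z => h z * P.dσ k z) x t - P.fourierHeat (pderiv k h) x t := by
  obtain ⟨j, hj⟩ := exists_ne k
  have hγk := P.γ_pos k
  have hl := P.l_pos'
  have hkl := P.γ_le k
  let g : (Fin n → ℝ) → ℂ := fun z => h z * (Real.exp (-(t * P.σ z)) : ℂ)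
  let g₁ : (Fin n → ℝ) → ℂ := fun z => pderiv k h z * (Real.exp (-(t * P.σ z)) : ℂ)
  let g₂ : (Fin n → ℝ) → ℂ := fun z => h z * P.dσ k z * (Real.exp (-(t * P.σ z)) : ℂ)
  -- The null hyperplane z_j = 0, with j ≠ k, contains the origin and is a union of lines parallel
  -- to e_k. Replacing g by 0 there changes nothing almost everywhere and gives a derivative along
  -- e_k at every point.
  let f : (Fin n → ℝ) → ℂ := fun z => if z j = 0 then 0 else g z
  let f' : (Fin n → ℝ) → ℂ := fun z => if z j = 0 then 0 else g₁ z - t * g₂ z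
  have hf : f =ᵐ[volume] g := by
    filter_upwards [ae_ne_zero n] with z hz
    exact if_neg (hz j)
  have hf' : f' =ᵐ[volume] fun z => g₁ z - t * g₂ z := by
    filter_upwards [ae_ne_zero n] with z hz
    exact if_neg (hz j)
  have hg : Integrable g := integrable_mul_exp H (by linarith) ht
  have hg₁ : Integrable g₁ := integrable_mul_exp (H.pderiv k) (by linarith) ht
  have hg₂ : Integrable g₂ := integrable_mul_exp (H.mul (P.isHomog_dσ k)) (by linarith) ht
  have hfi : Integrable f := hg.congr hf.symm
  have hfi' : Integrable f' := (hg₁.sub (hg₂.const_mul (t : ℂ))).congr hf'.symm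
  have hline : ∀ (z : Fin n → ℝ) (s : ℝ), (z + s • (Pi.single k 1 : Fin n → ℝ)) j = z j := by
    intro z s; simp [hj]
  have hder : ∀ z, HasLineDerivAt ℝ f (f' z) z (Pi.single k 1) := by
    intro z
    by_cases hz : z j = 0
    · simp only [HasLineDerivAt, f, f', hline, hz, if_true]
      exact hasDerivAt_const _ _
    · have hz0 : z ≠ 0 := by
        rintro rfl
        exact hz rfl
      simp only [HasLineDerivAt, f, f', hline, hz, if_false]
      exact hasLineDerivAt_mul_exp H t hz0 k
  have key := integral_bilinear_hasLineDerivAt_right_eq_neg_left_of_integrable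
    (μ := (volume : Measure (Fin n → ℝ))) (f := f) (f' := f') (g := phase x)
    (g' := fun z => Complex.I * x k * phase x z) (v := Pi.single k 1)
    (B := ContinuousLinearMap.mul ℝ ℂ)
    (by simpa [mul_comm] using integrable_phase_mul hfi' x)
    (by simpa [mul_comm, mul_assoc, mul_left_comm] using
      (integrable_phase_mul hfi x).const_mul (Complex.I * x k))
    (by simpa [mul_comm] using integrable_phase_mul hfi x)
    (fun z _ => hder z) (fun z _ => hasLineDerivAt_phase x z k)
  simp only [ContinuousLinearMap.mul_apply'] at key
  have e1 : ∫ z, f z * (Complex.I * x k * phase x z) =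
      Complex.I * x k * P.fourierHeat h x t := by
    rw [fourierHeat, ← integral_const_mul]
    refine integral_congr_ae ?_
    filter_upwards [hf] with z hz
    rw [hz]
    simp only [g]
    ring
  have e2 : ∫ z, f' z * phase x z = P.fourierHeat (pderiv k h) x t -
      t * P.fourierHeat (fun z => h z * P.dσ k z) x t := by
    rw [fourierHeat, fourierHeat, ← integral_const_mul, ← integral_sub
      (integrable_phase_mul hg₁ x) ((integrable_phase_mul hg₂ x).const_mul _)]
    refine integral_congr_ae ?_
    filter_upwards [hf'] with z hz
    rw [hz]
    simp only [g₁, g₂]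
    ring
  rw [e1, e2] at key
  rw [key]
  ring

variable {P} in
theorem norm_fourierHeat_le (h : (Fin n → ℝ) → ℂ) (x : Fin n → ℝ) (t : ℝ) :
    ‖P.fourierHeat h x t‖ ≤ ∫ z, ‖h z * (Real.exp (-(t * P.σ z)) : ℂ)‖ := by
  refine (norm_integral_le_integral_norm _).trans_eq ?_
  simp only [norm_mul (phase x _), norm_phase, one_mul]

variable {P} in
/-- Decay of the Fourier integral at time one. -/
theorem exists_coord_pow_mul_norm_le [Nontrivial (Fin n)] (k : Fin n) (a : ℕ) :
    ∀ {d : ℝ} {h : (Fin n → ℝ) → ℂ}, IsHomog P.γ d h → a * P.γ k < P.γnorm + d →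
      ∃ C : ℝ, ∀ x : Fin n → ℝ, |x k| ^ a * ‖P.fourierHeat h x 1‖ ≤ C := by
  have hγk := P.γ_pos k
  have hl := P.l_pos'
  induction a with
  | zero =>
    intro d h H hd
    exact ⟨_, fun x => by simpa using norm_fourierHeat_le h x 1⟩
  | succ a ih =>
    intro d h H hd
    push_cast at hd
    have hpos : 0 ≤ (a : ℝ) * P.γ k := by positivity
    -- ∂_k h loses degree γ_k, which is the cost of one integration by parts; h ∂_kσ has degree d +
    -- 2ℓ - γ_k > d and costs nothing.
    obtain ⟨C₁, hC₁⟩ := ih (H.pderiv k) (by linarith)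
    obtain ⟨C₂, hC₂⟩ := ih (H.mul (P.isHomog_dσ k)) (by linarith)
    refine ⟨C₂ + C₁, fun x => ?_⟩
    have h1 := coord_mul_fourierHeat H k (by linarith) one_pos x
    have h2 : |x k| * ‖P.fourierHeat h x 1‖ ≤
        ‖P.fourierHeat (fun z => h z * P.dσ k z) x 1‖ + ‖P.fourierHeat (pderiv k h) x 1‖ := by
      have := norm_sub_le (P.fourierHeat (fun z => h z * P.dσ k z) x 1)
        (P.fourierHeat (pderiv k h) x 1)
      rw [Complex.ofReal_one, one_mul] at h1
      rw [← h1] at this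
      simpa using this
    calc |x k| ^ (a + 1) * ‖P.fourierHeat h x 1‖
        = |x k| ^ a * (|x k| * ‖P.fourierHeat h x 1‖) := by ring
      _ ≤ |x k| ^ a * (‖P.fourierHeat (fun z => h z * P.dσ k z) x 1‖ +
          ‖P.fourierHeat (pderiv k h) x 1‖) := by gcongr
      _ ≤ C₂ + C₁ := by rw [mul_add]; exact add_le_add (hC₂ x) (hC₁ x)

variable {P} in
/-- Decay of the Fourier integral for small and for large times. -/
theorem exists_norm_fourierHeat_le [Nontrivial (Fin n)] {d : ℝ} {h : (Fin n → ℝ) → ℂ}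
    (H : IsHomog P.γ d h) (k : Fin n) (a : ℕ) (ha : a * P.γ k < P.γnorm + d) :
    ∃ C : ℝ, ∀ x : Fin n → ℝ, ∀ t : ℝ, 0 < t → |x k| ^ a * ‖P.fourierHeat h x t‖ ≤
      C * t ^ ((a * P.γ k - P.γnorm - d) / (2 * P.l)) := by
  obtain ⟨C, hC⟩ := exists_coord_pow_mul_norm_le k a H ha
  refine ⟨C, fun x t ht => ?_⟩
  have hl := P.l_pos'
  -- This dilation turns time t into time 1.
  set s : ℝ := t ^ (1 / (2 * (P.l : ℝ))) with hs
  have hspos : 0 < s := Real.rpow_pos_of_pos ht _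
  have hst : s ^ (-(2 * (P.l : ℝ))) * t = 1 := by
    rw [hs, ← Real.rpow_mul ht.le, show 1 / (2 * (P.l : ℝ)) * -(2 * P.l) = -1 by field_simp,
      Real.rpow_neg_one, inv_mul_cancel₀ ht.ne']
  have h1 := fourierHeat_dilate H hspos (dilate P.γ s⁻¹ x) t
  rw [dilate_dilate_inv _ hspos, hst] at h1
  have h2 := hC (dilate P.γ s⁻¹ x)
  have h3 : |x k| = s ^ P.γ k * |dilate P.γ s⁻¹ x k| := by
    conv_lhs => rw [← dilate_dilate_inv P.γ hspos x]
    simp only [dilate, abs_mul, abs_of_pos (Real.rpow_pos_of_pos hspos (P.γ k))]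
  have h4 : t ^ ((a * P.γ k - P.γnorm - d) / (2 * P.l)) =
      (s ^ P.γ k) ^ a * s ^ (-P.γnorm - d) := by
    rw [← Real.rpow_natCast (s ^ P.γ k), ← Real.rpow_mul hspos.le, ← Real.rpow_add hspos, hs,
      ← Real.rpow_mul ht.le]
    congr 1
    ring
  rw [h1, norm_mul, Complex.norm_real, Real.norm_of_nonneg (by positivity), h3, h4, mul_pow]
  calc _ = (s ^ P.γ k) ^ a * s ^ (-P.γnorm - d) *
        (|dilate P.γ s⁻¹ x k| ^ a * ‖P.fourierHeat h (dilate P.γ s⁻¹ x) 1‖) := by ring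
    _ ≤ (s ^ P.γ k) ^ a * s ^ (-P.γnorm - d) * C := by gcongr
    _ = _ := by ring

variable {P} in
/-- For `x_k ≠ 0` the Fourier integral is bounded by an integrable power of `t` near `t = 0`. -/
theorem exists_norm_fourierHeat_le_small [Nontrivial (Fin n)] {d : ℝ} {h : (Fin n → ℝ) → ℂ}
    (H : IsHomog P.γ d h) (hd : 2 * P.l - P.γnorm < d) (k : Fin n) :
    ∃ (a : ℕ) (e C : ℝ), -1 < e ∧ ∀ x : Fin n → ℝ, ∀ t : ℝ, 0 < t →
      |x k| ^ a * ‖P.fourierHeat h x t‖ ≤ C * t ^ e := by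
  have hγk := P.γ_pos k
  have hl := P.l_pos'
  have hkl := P.γ_le k
  have hX : 0 ≤ (P.γnorm + d - 2 * P.l) / P.γ k := div_nonneg (by linarith) hγk.le
  -- The least a with a γ_k > ‖γ‖ + d - 2ℓ, which makes the exponent of t exceed -1. Since γ_k ≤ ℓ <
  -- 2ℓ, also a γ_k < ‖γ‖ + d, so that many integrations by parts are allowed.
  set a := ⌊(P.γnorm + d - 2 * P.l) / P.γ k⌋₊ + 1 with ha
  have h1 : (a : ℝ) * P.γ k ≤ P.γnorm + d - 2 * P.l + P.γ k := by
    have := Nat.floor_le hX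
    rw [le_div_iff₀ hγk] at this
    rw [ha]
    push_cast
    linarith
  have h2 : P.γnorm + d - 2 * P.l < a * P.γ k := by
    have := Nat.lt_floor_add_one ((P.γnorm + d - 2 * P.l) / P.γ k)
    rw [div_lt_iff₀ hγk] at this
    rw [ha]
    push_cast
    exact this
  obtain ⟨C, hC⟩ := exists_norm_fourierHeat_le H k a (by linarith)
  refine ⟨a, _, C, ?_, hC⟩
  rw [lt_div_iff₀ (by positivity)]
  linarith

variable {P} in
/-- Locally uniform domination of the Fourier integral away from the hyperplane `x_k = 0`. -/
theorem exists_integrable_bound [Nontrivial (Fin n)] {d : ℝ} {h : (Fin n → ℝ) → ℂ}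
    (H : IsHomog P.γ d h) (hd : 2 * P.l - P.γnorm < d) (k : Fin n) {r : ℝ} (hr : 0 < r) :
    ∃ b : ℝ → ℝ, IntegrableOn b (Ioi 0) ∧ ∀ x : Fin n → ℝ, r ≤ |x k| → ∀ t : ℝ, 0 < t →
      ‖P.fourierHeat h x t‖ ≤ b t := by
  have hl := P.l_pos'
  obtain ⟨a, e, C₀, he, hC₀⟩ := exists_norm_fourierHeat_le_small H hd k
  obtain ⟨C₁, hC₁⟩ := exists_norm_fourierHeat_le H k 0 (by push_cast; linarith)
  set e₁ : ℝ := (((0 : ℕ) : ℝ) * P.γ k - P.γnorm - d) / (2 * P.l)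
  have he₁ : e₁ < -1 := by
    rw [div_lt_iff₀ (by positivity)]
    push_cast
    linarith
  -- Up to time 1 the bound after a integrations by parts is used; after time 1 the one with none,
  -- whose exponent is below -1 because d > 2ℓ - ‖γ‖.
  refine ⟨fun t => if t ≤ 1 then C₀ / r ^ a * t ^ e else C₁ * t ^ e₁, ?_, ?_⟩
  · rw [← Ioc_union_Ioi_eq_Ioi zero_le_one]
    refine IntegrableOn.union ?_ ?_
    · have h1 := (intervalIntegral.intervalIntegrable_rpow' (a := 0) (b := 1) he).const_mul
        (C₀ / r ^ a)
      rw [intervalIntegrable_iff_integrableOn_Ioc_of_le zero_le_one] at h1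
      refine h1.congr_fun (fun t ht => ?_) measurableSet_Ioc
      rw [if_pos ht.2]
    · have h1 : IntegrableOn (fun t => C₁ * t ^ e₁) (Ioi 1) :=
        (integrableOn_Ioi_rpow_of_lt he₁ one_pos).const_mul C₁
      refine h1.congr_fun (fun t ht => ?_) measurableSet_Ioi
      rw [if_neg (not_le.2 ht)]
  · intro x hx t ht
    dsimp only
    by_cases h1 : t ≤ 1
    · rw [if_pos h1, div_mul_eq_mul_div,
        le_div_iff₀ (by positivity), mul_comm]
      refine le_trans ?_ (hC₀ x t ht)
      gcongr
    · rw [if_neg h1]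
      simpa using hC₁ x t ht

end SemiellipticOperator

/-! ### Differentiation under the integral sign -/

namespace Semielliptic

variable {n : ℕ}

/-- The linear form `y ↦ ∑ k, y k * c k`. -/
def grad (c : Fin n → ℂ) : (Fin n → ℝ) →L[ℝ] ℂ :=
  ∑ k, (ContinuousLinearMap.proj k : (Fin n → ℝ) →L[ℝ] ℝ).smulRight (c k)

theorem grad_apply (c : Fin n → ℂ) (y : Fin n → ℝ) : grad c y = ∑ k, (y k : ℂ) * c k := by
  simp [grad]

theorem grad_single (c : Fin n → ℂ) (k : Fin n) : grad c (Pi.single k 1) = c k := by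
  rw [grad_apply, Finset.sum_eq_single k]
  · simp
  · intro j _ hj; simp [hj]
  · simp

theorem norm_grad_le (c : Fin n → ℂ) : ‖grad c‖ ≤ ∑ k, ‖c k‖ := by
  refine ContinuousLinearMap.opNorm_le_bound _ (Finset.sum_nonneg fun k _ => norm_nonneg _) ?_
  intro y
  rw [grad_apply, Finset.sum_mul]
  refine norm_sum_le_of_le _ fun k _ => ?_
  rw [norm_mul, Complex.norm_real, mul_comm]
  gcongr
  exact norm_le_pi_norm y k

theorem continuous_grad : Continuous (grad : (Fin n → ℂ) → _) := by
  have : (grad : (Fin n → ℂ) → _) = fun c => ∑ k, ContinuousLinearMap.smulRightL ℝ (Fin n → ℝ) ℂ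
      (ContinuousLinearMap.proj k) (c k) := by
    funext c; rfl
  rw [this]
  fun_prop

theorem contDiff_grad {N : WithTop ℕ∞} : ContDiff ℝ N (grad : (Fin n → ℂ) → _) := by
  have : (grad : (Fin n → ℂ) → _) = fun c => ∑ k, ContinuousLinearMap.smulRightL ℝ (Fin n → ℝ) ℂ
      (ContinuousLinearMap.proj k) (c k) := by
    funext c; rfl
  rw [this]
  exact ContDiff.sum fun k _ => (ContinuousLinearMap.contDiff _).comp (contDiff_apply ℝ ℂ k)

theorem integral_grad {α : Type*} [MeasurableSpace α] {μ : Measure α} {c : Fin n → α → ℂ}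
    (hc : ∀ k, Integrable (c k) μ) :
    ∫ a, grad (fun k => c k a) ∂μ = grad fun k => ∫ a, c k a ∂μ := by
  simp only [grad]
  have h1 : ∀ k, Integrable (fun a => ContinuousLinearMap.smulRightL ℝ (Fin n → ℝ) ℂ
      (ContinuousLinearMap.proj k) (c k a)) μ := fun k => ContinuousLinearMap.integrable_comp _ (hc k)
  refine (integral_finsetSum _ fun k _ => h1 k).trans (Finset.sum_congr rfl fun k _ => ?_)
  exact ContinuousLinearMap.integral_comp_comm _ (hc k)

/-- Differentiation under the integral sign, in terms of partial derivatives. -/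
theorem hasFDerivAt_integral_grad {α : Type*} [MeasurableSpace α] {μ : Measure α}
    {f : (Fin n → ℝ) → α → ℂ} {f' : Fin n → (Fin n → ℝ) → α → ℂ} {x₀ : Fin n → ℝ}
    {s : Set (Fin n → ℝ)} {b : Fin n → α → ℝ} (hs : s ∈ nhds x₀)
    (hf : ∀ x, AEStronglyMeasurable (f x) μ) (hfi : Integrable (f x₀) μ)
    (hf' : ∀ k, AEStronglyMeasurable (f' k x₀) μ)
    (hb : ∀ k, ∀ᵐ a ∂μ, ∀ x ∈ s, ‖f' k x a‖ ≤ b k a) (hbi : ∀ k, Integrable (b k) μ)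
    (hd : ∀ᵐ a ∂μ, ∀ x ∈ s, HasFDerivAt (fun x => f x a) (grad fun k => f' k x a) x) :
    HasFDerivAt (fun x => ∫ a, f x a ∂μ) (grad fun k => ∫ a, f' k x₀ a ∂μ) x₀ := by
  have hfi' : ∀ k, Integrable (f' k x₀) μ := fun k =>
    (hbi k).mono' (hf' k) ((hb k).mono fun a ha => ha x₀ (mem_of_mem_nhds hs))
  rw [← integral_grad hfi']
  refine hasFDerivAt_integral_of_dominated_of_fderiv_le (F' := fun x a => grad fun k => f' k x a)
    (bound := fun a => ∑ k, b k a) hs (Filter.Eventually.of_forall hf) hfi ?_ ?_ ?_ hd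
  · exact continuous_grad.comp_aestronglyMeasurable
      (aemeasurable_pi_iff.2 fun k => (hf' k).aemeasurable).aestronglyMeasurable
  · filter_upwards [ae_all_iff.2 hb] with a ha x hx
    exact (norm_grad_le _).trans (Finset.sum_le_sum fun k _ => ha k x hx)
  · exact integrable_finsetSum _ fun k _ => hbi k

/-- Multiplication by `i z_k`. -/
def coordMul (k : Fin n) (h : (Fin n → ℝ) → ℂ) : (Fin n → ℝ) → ℂ :=
  fun z => Complex.I * z k * h z

theorem IsHomog.coordMul {γ : Fin n → ℝ} {d : ℝ} {h : (Fin n → ℝ) → ℂ} (H : IsHomog γ d h)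
    (k : Fin n) : IsHomog γ (γ k + d) (coordMul k h) :=
  ((IsHomog.coord γ k).const_mul Complex.I).mul H

end Semielliptic

namespace SemiellipticOperator

open Semielliptic

variable {n m : ℕ} (P : SemiellipticOperator n m)

theorem hasFDerivAt_phase (x z : Fin n → ℝ) :
    HasFDerivAt (fun x => phase x z) (grad fun k => Complex.I * z k * phase x z) x := by
  have h1 : ∀ x, phase x z = Complex.exp (grad (fun k => Complex.I * z k) x) := by
    intro x
    rw [phase, grad_apply]
    push_cast
    rw [Finset.mul_sum]
    congr 1
    exact Finset.sum_congr rfl fun k _ => by ring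
  have h2 := (grad fun k => Complex.I * (z k : ℂ)).hasFDerivAt (x := x) |>.cexp
  simp only [← h1] at h2
  refine h2.congr_fderiv ?_
  ext y
  simp only [smul_apply, grad_apply, smul_eq_mul, Finset.mul_sum]
  exact Finset.sum_congr rfl fun k _ => by ring

variable {P}
variable [Nontrivial (Fin n)] {d : ℝ} {h : (Fin n → ℝ) → ℂ}

theorem hasFDerivAt_fourierHeat (H : IsHomog P.γ d h) (hd : -P.γnorm < d) {t : ℝ} (ht : 0 < t)
    (x : Fin n → ℝ) : HasFDerivAt (fun x => P.fourierHeat h x t)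
      (grad fun k => P.fourierHeat (coordMul k h) x t) x := by
  have hi := integrable_mul_exp H hd ht
  have hi' : ∀ k, Integrable fun z => coordMul k h z * (Real.exp (-(t * P.σ z)) : ℂ) := fun k =>
    integrable_mul_exp (H.coordMul k) (by linarith [P.γ_pos k]) ht
  refine hasFDerivAt_integral_grad
    (f := fun x z => phase x z * (h z * (Real.exp (-(t * P.σ z)) : ℂ)))
    (f' := fun k x z => phase x z * (coordMul k h z * (Real.exp (-(t * P.σ z)) : ℂ)))
    (b := fun k z => ‖coordMul k h z * (Real.exp (-(t * P.σ z)) : ℂ)‖)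
    Filter.univ_mem (fun x => (integrable_phase_mul hi x).aestronglyMeasurable)
    (integrable_phase_mul hi x) (fun k => (integrable_phase_mul (hi' k) x).aestronglyMeasurable)
    (fun k => ae_of_all _ fun z x _ => ?_) (fun k => (hi' k).norm)
    (ae_of_all _ fun z x _ => ?_)
  · rw [norm_mul, norm_phase, one_mul]
  · refine ((hasFDerivAt_phase x z).mul_const (h z * (Real.exp (-(t * P.σ z)) : ℂ))).congr_fderiv ?_
    ext y
    simp only [smul_apply, grad_apply, smul_eq_mul, Finset.mul_sum, coordMul]
    exact Finset.sum_congr rfl fun k _ => by ring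

theorem hasDerivAt_fourierHeat (H : IsHomog P.γ d h) (hd : -P.γnorm < d) {t : ℝ} (ht : 0 < t)
    (x : Fin n → ℝ) : HasDerivAt (fun t => P.fourierHeat h x t)
      (-P.fourierHeat (fun z => h z * P.σ z) x t) t := by
  have hl := P.l_pos'
  have hi : ∀ t : ℝ, 0 < t → Integrable fun z => h z * (Real.exp (-(t * P.σ z)) : ℂ) :=
    fun t ht => integrable_mul_exp H hd ht
  have hi' : ∀ t : ℝ, 0 < t → Integrable fun z => h z * P.σ z * (Real.exp (-(t * P.σ z)) : ℂ) :=
    fun t ht => integrable_mul_exp (H.mul P.isHomog_σ) (by linarith) ht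
  rw [fourierHeat, ← integral_neg]
  -- On the neighbourhood (t/2, ∞) of t, the exponential at time t/2 dominates.
  refine (hasDerivAt_integral_of_dominated_loc_of_deriv_le
    (F := fun t z => phase x z * (h z * (Real.exp (-(t * P.σ z)) : ℂ)))
    (F' := fun t z => -(phase x z * (h z * P.σ z * (Real.exp (-(t * P.σ z)) : ℂ))))
    (bound := fun z => ‖h z * P.σ z * (Real.exp (-(t / 2 * P.σ z)) : ℂ)‖)
    (Ioi_mem_nhds (half_lt_self ht)) ?_ (integrable_phase_mul (hi t ht) x)
    (integrable_phase_mul (hi' t ht) x).neg.aestronglyMeasurable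
    (ae_of_all _ fun z u hu => ?_) (hi' _ (by positivity)).norm
    (ae_of_all _ fun z u hu => ?_)).2
  · filter_upwards [Ioi_mem_nhds ht] with u hu
    exact (integrable_phase_mul (hi u hu) x).aestronglyMeasurable
  · simp only [norm_neg, norm_mul, norm_phase, one_mul, Complex.norm_real, Real.norm_eq_abs,
      Real.abs_exp]
    gcongr
    · exact P.σ_nonneg z
    · exact (mem_Ioi.1 hu).le
  · have h1 : HasDerivAt (fun u : ℝ => ((Real.exp (-(u * P.σ z)) : ℝ) : ℂ))
        ((Real.exp (-(u * P.σ z)) * -(1 * P.σ z) : ℝ) : ℂ) u :=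
      (((hasDerivAt_id u).mul_const (P.σ z)).neg.exp).ofReal_comp
    refine ((h1.const_mul (h z)).const_mul (phase x z)).congr_deriv ?_
    push_cast
    ring

theorem aestronglyMeasurable_fourierHeat (H : IsHomog P.γ d h) (hd : -P.γnorm < d)
    (x : Fin n → ℝ) :
    AEStronglyMeasurable (fun t => P.fourierHeat h x t) (volume.restrict (Ioi 0)) :=
  ContinuousOn.aestronglyMeasurable
    (fun _ ht => (hasDerivAt_fourierHeat H hd ht x).continuousAt.continuousWithinAt)
    measurableSet_Ioi

theorem integrableOn_fourierHeat (H : IsHomog P.γ d h) (hd : 2 * P.l - P.γnorm < d)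
    {x : Fin n → ℝ} (hx : x ≠ 0) : IntegrableOn (fun t => P.fourierHeat h x t) (Ioi 0) := by
  have hl := P.l_pos'
  obtain ⟨k, hk⟩ := Function.ne_iff.1 hx
  obtain ⟨b, hb, hle⟩ := exists_integrable_bound H hd k (abs_pos.2 hk)
  refine Integrable.mono' hb (aestronglyMeasurable_fourierHeat H (by linarith) x) ?_
  filter_upwards [ae_restrict_mem measurableSet_Ioi] with t ht
  exact hle x le_rfl t ht

variable (P) in
/-- The iterated integral `∫_0^∞ ∫ e^{ix·z} h(z) e^{-tσ(z)} dz dt`. -/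
def timeIntegral (h : (Fin n → ℝ) → ℂ) (x : Fin n → ℝ) : ℂ :=
  ∫ t in Ioi (0 : ℝ), P.fourierHeat h x t

theorem hasFDerivAt_timeIntegral (H : IsHomog P.γ d h) (hd : 2 * P.l - P.γnorm < d)
    {x : Fin n → ℝ} (hx : x ≠ 0) : HasFDerivAt (P.timeIntegral h)
      (grad fun k => P.timeIntegral (coordMul k h) x) x := by
  have hl := P.l_pos'
  obtain ⟨j, hj⟩ := Function.ne_iff.1 hx
  have hj' : 0 < |x j| := abs_pos.2 hj
  have hd' : ∀ k, 2 * P.l - P.γnorm < P.γ k + d := fun k => by linarith [P.γ_pos k]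
  choose b hb hle using fun k => exists_integrable_bound (H.coordMul k) (hd' k) j (half_pos hj')
  -- Near x the j-th coordinate stays away from 0, so one integrable bound in t serves all nearby
  -- points.
  have hs : {y : Fin n → ℝ | |x j| / 2 < |y j|} ∈ nhds x :=
    (isOpen_lt continuous_const (by fun_prop)).mem_nhds (half_lt_self hj')
  refine hasFDerivAt_integral_grad (f := fun x t => P.fourierHeat h x t)
    (f' := fun k x t => P.fourierHeat (coordMul k h) x t) (b := b) hs
    (fun x => aestronglyMeasurable_fourierHeat H (by linarith) x)
    (integrableOn_fourierHeat H hd hx)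
    (fun k => aestronglyMeasurable_fourierHeat (H.coordMul k) (by linarith [hd' k]) x)
    (fun k => ?_) hb ?_
  · filter_upwards [ae_restrict_mem measurableSet_Ioi] with t ht y hy
    exact hle k y (le_of_lt hy) t ht
  · filter_upwards [ae_restrict_mem measurableSet_Ioi] with t ht y hy
    exact hasFDerivAt_fourierHeat H (by linarith) ht y

/-- The partial derivatives are time integrals of i z_k h, which satisfy the same hypotheses with a
larger degree; hence the induction over all d and h. -/
theorem contDiffOn_timeIntegral_nat (N : ℕ) : ∀ {d : ℝ} {h : (Fin n → ℝ) → ℂ},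
    IsHomog P.γ d h → 2 * P.l - P.γnorm < d → ContDiffOn ℝ N (P.timeIntegral h) {0}ᶜ := by
  induction N with
  | zero =>
    intro d h H hd
    exact contDiffOn_zero.2 fun x hx =>
      (hasFDerivAt_timeIntegral H hd hx).continuousAt.continuousWithinAt
  | succ N ih =>
    intro d h H hd
    push_cast
    rw [contDiffOn_succ_iff_fderiv_of_isOpen isOpen_compl_zero]
    refine ⟨fun x hx => (hasFDerivAt_timeIntegral H hd hx).differentiableAt.differentiableWithinAt,
      by simp, ?_⟩
    have h1 : ContDiffOn ℝ N (fun x => grad fun k => P.timeIntegral (coordMul k h) x) {0}ᶜ :=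
      contDiff_grad.comp_contDiffOn (contDiffOn_pi.2 fun k =>
        ih (H.coordMul k) (by linarith [P.γ_pos k]))
    exact h1.congr fun x hx => (hasFDerivAt_timeIntegral H hd hx).fderiv

/-- Both changes of variables, in z and in t, remain valid for divergent integrals, whose value is 0
by convention; hence x = 0 is included. -/
theorem timeIntegral_dilate (H : IsHomog P.γ d h) {s : ℝ} (hs : 0 < s) (x : Fin n → ℝ) :
    P.timeIntegral h (dilate P.γ s x) =
      ((s ^ (2 * P.l - P.γnorm - d) : ℝ) : ℂ) * P.timeIntegral h x := by
  have hp : 0 < s ^ (-(2 * (P.l : ℝ))) := Real.rpow_pos_of_pos hs _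
  simp only [timeIntegral, fourierHeat_dilate H hs]
  rw [integral_const_mul, integral_comp_mul_left_Ioi (fun t => P.fourierHeat h x t) 0 hp, mul_zero,
    Complex.real_smul, ← mul_assoc, ← Complex.ofReal_mul, ← Real.rpow_neg hs.le,
    ← Real.rpow_add hs]
  congr 3
  ring

theorem isHomog_timeIntegral (H : IsHomog P.γ d h) (hd : 2 * P.l - P.γnorm < d) :
    IsHomog P.γ (2 * P.l - P.γnorm - d) (P.timeIntegral h) where
  smooth := contDiffOn_infty.2 fun N => contDiffOn_timeIntegral_nat N H hd
  homog _ hs x _ := timeIntegral_dilate H hs x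

theorem pderiv_timeIntegral (H : IsHomog P.γ d h) (hd : 2 * P.l - P.γnorm < d)
    {x : Fin n → ℝ} (hx : x ≠ 0) (k : Fin n) :
    pderiv k (P.timeIntegral h) x = P.timeIntegral (coordMul k h) x := by
  have := (hasFDerivAt_timeIntegral H hd hx).hasLineDerivAt (Pi.single k 1)
  rw [grad_single] at this
  exact this.lineDeriv

/-! ### Vanishing of the time integral of σ -/

/-- `∫_0^∞ ∫ e^{ix·z} σ(z) e^{-tσ(z)} dz dt = 0` for `x ≠ 0`. -/
theorem timeIntegral_σ (hγ : (P.l : ℝ) < P.γnorm) {x : Fin n → ℝ} (hx : x ≠ 0) :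
    P.timeIntegral (fun z => (P.σ z : ℂ)) x = 0 := by
  have hl := P.l_pos'
  have hγ0 := P.γnorm_pos
  obtain ⟨k, hk⟩ := Function.ne_iff.1 hx
  have hk' : 0 < |x k| := abs_pos.2 hk
  have hkl := P.γ_le k
  have H1 := IsHomog.const P.γ 1
  set K : ℝ → ℂ := fun t => P.fourierHeat (fun _ => 1) x t with hK
  have hder : ∀ t ∈ Ioi (0 : ℝ), HasDerivAt K (-P.fourierHeat (fun z => (P.σ z : ℂ)) x t) t := by
    intro t ht
    simpa only [one_mul] using hasDerivAt_fourierHeat H1 (by linarith) ht x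
  have htop : Filter.Tendsto K Filter.atTop (nhds 0) := by
    obtain ⟨C, hC⟩ := exists_norm_fourierHeat_le H1 k 0 (by push_cast; linarith)
    have h1 : Filter.Tendsto (fun t : ℝ => C * t ^ (-(P.γnorm / (2 * P.l)))) Filter.atTop
        (nhds 0) := by
      simpa using (tendsto_rpow_neg_atTop (y := P.γnorm / (2 * P.l)) (by positivity)).const_mul C
    refine squeeze_zero_norm' ?_ h1
    filter_upwards [Filter.eventually_gt_atTop 0] with t ht
    have h2 := hC x t ht
    rw [pow_zero, one_mul] at h2
    refine h2.trans_eq ?_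
    congr 2
    push_cast
    ring
  -- One integration by parts with h = 1 gives i x_k K(t) = t G(t), where G is the Fourier integral
  -- of ∂_kσ. As γ_k ≤ ℓ < ‖γ‖, the small-time bound applies to G with an exponent e > -1, so K =
  -- O(t^{e+1}).
  have hbot : Filter.Tendsto K (nhdsWithin 0 (Ioi 0)) (nhds 0) := by
    obtain ⟨a, e, C, he, hC⟩ := exists_norm_fourierHeat_le_small
      (H1.mul (P.isHomog_dσ k)) (by linarith) k
    have h1 : Filter.Tendsto (fun t : ℝ => C / |x k| ^ (a + 1) * t ^ (e + 1))
        (nhdsWithin 0 (Ioi 0)) (nhds 0) := by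
      have h2 : Filter.Tendsto (fun t : ℝ => t ^ (e + 1)) (nhds 0) (nhds 0) := by
        have := (Real.continuousAt_rpow_const 0 (e + 1) (Or.inr (by linarith))).tendsto
        rwa [Real.zero_rpow (by linarith)] at this
      simpa using (h2.mono_left nhdsWithin_le_nhds).const_mul (C / |x k| ^ (a + 1))
    refine squeeze_zero_norm' ?_ h1
    filter_upwards [self_mem_nhdsWithin] with t ht
    have ht' : 0 < t := ht
    have h3 := hC x t ht
    have h4 := coord_mul_fourierHeat H1 k (by linarith) ht x
    have h5 : P.fourierHeat (pderiv k fun _ => 1) x t = 0 := by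
      have : (pderiv k fun _ : Fin n → ℝ => (1 : ℂ)) = fun _ => 0 := by
        funext z
        simp [pderiv, lineDeriv]
      simp [this, fourierHeat]
    rw [h5, sub_zero] at h4
    have h6 : |x k| * ‖K t‖ = t * ‖P.fourierHeat (fun z => 1 * P.dσ k z) x t‖ := by
      have := congrArg norm h4
      simpa [abs_of_pos ht'] using this
    rw [div_mul_eq_mul_div, le_div_iff₀ (by positivity), Real.rpow_add ht', Real.rpow_one]
    calc ‖K t‖ * |x k| ^ (a + 1) = |x k| ^ a * (|x k| * ‖K t‖) := by ring
      _ = t * (|x k| ^ a * ‖P.fourierHeat (fun z => 1 * P.dσ k z) x t‖) := by rw [h6]; ring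
      _ ≤ t * (C * t ^ e) := by gcongr
      _ = C * (t ^ e * t) := by ring
  have hint : IntegrableOn (fun t => -P.fourierHeat (fun z => (P.σ z : ℂ)) x t) (Ioi 0) :=
    (integrableOn_fourierHeat P.isHomog_σ (by linarith) hx).neg
  -- The value at t = 0 is set to the limit 0, which gives continuity from the right there.
  have key := integral_Ioi_of_hasDerivAt_of_tendsto (f := Function.update K 0 0) (a := 0)
    (f' := fun t => -P.fourierHeat (fun z => (P.σ z : ℂ)) x t) (m := 0) ?_ ?_ hint ?_
  · rw [integral_neg, Function.update_self, sub_zero, neg_eq_zero] at key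
    exact key
  · rw [continuousWithinAt_update_same]
    simpa using hbot
  · intro t ht
    refine (hder t ht).congr_of_eventuallyEq ?_
    filter_upwards [Ioi_mem_nhds (mem_Ioi.1 ht)] with u hu
    exact Function.update_of_ne (ne_of_gt hu) _ _
  · refine htop.congr' ?_
    filter_upwards [Filter.eventually_gt_atTop 0] with u hu
    exact (Function.update_of_ne (ne_of_gt hu) _ _).symm

end SemiellipticOperator

/-! ### Iterated partial derivatives and the matrix norm -/

namespace Semielliptic

variable {n : ℕ}

theorem iPow_add_single (z : Fin n → ℝ) (β : Fin n → ℕ) (k : Fin n) :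
    iPow z (β + Pi.single k 1) = Complex.I * z k * iPow z β := by
  simp only [iPow, Pi.add_apply, pow_add, Finset.prod_mul_distrib]
  rw [mul_comm, Finset.prod_eq_single (s := Finset.univ)
    (f := fun j => (Complex.I * (z j : ℂ)) ^ (Pi.single k 1 : Fin n → ℕ) j) k]
  · simp
  · intro j _ hj; simp [hj]
  · simp

theorem dot_nonneg {γ : Fin n → ℝ} (hγ : ∀ k, 0 < γ k) (β : Fin n → ℕ) : 0 ≤ dot β γ :=
  Finset.sum_nonneg fun k _ => mul_nonneg (Nat.cast_nonneg _) (hγ k).le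

theorem pderiv_congr {f g : (Fin n → ℝ) → ℂ} (hfg : EqOn f g {0}ᶜ) (k : Fin n) :
    EqOn (pderiv k f) (pderiv k g) {0}ᶜ := fun _ hx =>
  (hfg.eventuallyEq_of_mem (isOpen_compl_zero.mem_nhds hx)).lineDeriv_eq

/-- If `∂_k (u β) = u (β + e_k)` away from the origin, then `∂^β (u 0) = u β` there. -/
theorem mderiv_eq_of_pderiv {u : (Fin n → ℕ) → (Fin n → ℝ) → ℂ}
    (hu : ∀ β k, EqOn (pderiv k (u β)) (u (β + Pi.single k 1)) {0}ᶜ) (β : Fin n → ℕ) :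
    EqOn (mderiv β (u 0)) (u β) {0}ᶜ := by
  have hiter : ∀ (k : Fin n) (a : ℕ) (f : (Fin n → ℝ) → ℂ) (δ : Fin n → ℕ), EqOn f (u δ) {0}ᶜ →
      EqOn ((pderiv k)^[a] f) (u (a • Pi.single k 1 + δ)) {0}ᶜ := by
    intro k a
    induction a with
    | zero => intro f δ hf; simpa using hf
    | succ a ih =>
      intro f δ hf
      rw [Function.iterate_succ_apply]
      have := ih _ _ ((pderiv_congr hf k).trans (hu δ k))
      rwa [add_comm δ, ← add_assoc, ← succ_nsmul] at this
  have hfold : ∀ L : List (Fin n), EqOn (L.foldr (fun k g => (pderiv k)^[β k] g) (u 0))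
      (u (L.map fun k => β k • (Pi.single k 1 : Fin n → ℕ)).sum) {0}ᶜ := by
    intro L
    induction L with
    | nil => exact fun _ _ => rfl
    | cons k L ih =>
      simp only [List.foldr_cons, List.map_cons, List.sum_cons]
      exact hiter k _ _ _ ih
  have hsum : ((List.finRange n).map fun k => β k • (Pi.single k 1 : Fin n → ℕ)).sum = β := by
    rw [← Fin.sum_univ_def]
    funext j
    simp [Finset.sum_apply, Pi.single_apply]
  have := hfold (List.finRange n)
  rwa [hsum] at this

theorem frob_le_sum {m p : ℕ} (M : Matrix (Fin m) (Fin p) ℂ) : frob M ≤ ∑ i, ∑ j, ‖M i j‖ := by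
  refine Real.sqrt_le_iff.2 ⟨by positivity, ?_⟩
  calc ∑ i, ∑ j, ‖M i j‖ ^ 2 ≤ ∑ i, (∑ j, ‖M i j‖) ^ 2 :=
        Finset.sum_le_sum fun i _ => Finset.sum_sq_le_sq_sum_of_nonneg fun j _ => norm_nonneg _
    _ ≤ _ := Finset.sum_sq_le_sq_sum_of_nonneg fun i _ => by positivity

end Semielliptic

/-! ### The functions F_β and the equation -/

namespace SemiellipticOperator

open Semielliptic

variable {n m : ℕ} (P : SemiellipticOperator n m)

/-- The entries of `(iz)^β σ(z) L(z)⁻¹`. -/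
def kernel (β : Fin n → ℕ) (i j : Fin m) (z : Fin n → ℝ) : ℂ :=
  iPow z β * P.σ z * (P.symbol z)⁻¹ i j

theorem isHomog_kernel (β : Fin n → ℕ) (i j : Fin m) :
    IsHomog P.γ (dot β P.γ + P.l) (P.kernel β i j) := by
  have := ((IsHomog.iPow P.γ β).mul P.isHomog_σ).mul (P.isHomog_symbol_inv i j)
  rwa [show dot β P.γ + 2 * P.l + -P.l = dot β P.γ + (P.l : ℝ) by ring] at this

theorem coordMul_kernel (β : Fin n → ℕ) (i j : Fin m) (k : Fin n) :
    coordMul k (P.kernel β i j) = P.kernel (β + Pi.single k 1) i j := by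
  funext z
  simp only [coordMul, kernel, iPow_add_single]
  ring

theorem integrandβ_apply (β : Fin n → ℕ) (x : Fin n → ℝ) (t : ℝ) (z : Fin n → ℝ) (i j : Fin m) :
    P.integrandβ β x t z i j =
      phase x z * (P.kernel β i j z * (Real.exp (-(t * P.σ z)) : ℂ)) := by
  simp only [integrandβ, kernel, phase, Matrix.smul_apply, smul_eq_mul]
  ring

theorem Jβ_apply (β : Fin n → ℕ) (x : Fin n → ℝ) (t : ℝ) (i j : Fin m) :
    P.Jβ β x t i j = P.fourierHeat (P.kernel β i j) x t := by
  simp only [Jβ, Matrix.of_apply, fourierHeat, integrandβ_apply]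

theorem Fβ_apply (β : Fin n → ℕ) (x : Fin n → ℝ) (i j : Fin m) :
    P.Fβ β x i j = ((((2 * Real.pi) ^ n)⁻¹ : ℝ) : ℂ) * P.timeIntegral (P.kernel β i j) x := by
  simp only [Fβ, Matrix.smul_apply, Matrix.of_apply, Complex.real_smul, timeIntegral, Jβ_apply]

theorem F_eq : P.F = P.Fβ 0 := by
  funext x
  simp only [F, Fβ, Jβ, integrand, integrandβ, iPow, Pi.zero_apply, pow_zero, Finset.prod_const_one,
    mul_one, Matrix.of_apply]

variable [Nontrivial (Fin n)]

theorem isHomog_Fβ (hγ : (P.l : ℝ) < P.γnorm) (β : Fin n → ℕ) (i j : Fin m) :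
    IsHomog P.γ (P.l - dot β P.γ - P.γnorm) (fun x => P.Fβ β x i j) := by
  have := (isHomog_timeIntegral (P.isHomog_kernel β i j)
    (by linarith [dot_nonneg P.γ_pos β])).const_mul ((((2 * Real.pi) ^ n)⁻¹ : ℝ) : ℂ)
  simp only [Fβ_apply]
  rwa [show 2 * P.l - P.γnorm - (dot β P.γ + P.l) = P.l - dot β P.γ - P.γnorm by ring] at this

theorem pderiv_Fβ (hγ : (P.l : ℝ) < P.γnorm) (β : Fin n → ℕ) (i j : Fin m) (k : Fin n) :
    EqOn (pderiv k fun x => P.Fβ β x i j) (fun x => P.Fβ (β + Pi.single k 1) x i j) {0}ᶜ := by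
  intro x hx
  have hd : 2 * P.l - P.γnorm < dot β P.γ + P.l := by linarith [dot_nonneg P.γ_pos β]
  have H := P.isHomog_kernel β i j
  have h1 := (isHomog_timeIntegral H hd).hasLineDerivAt hx k
  rw [pderiv_timeIntegral H hd hx, coordMul_kernel] at h1
  simp only [Fβ_apply]
  exact (HasDerivAt.const_mul ((((2 * Real.pi) ^ n)⁻¹ : ℝ) : ℂ) h1).deriv

theorem matDeriv_F (hγ : (P.l : ℝ) < P.γnorm) (β : Fin n → ℕ) {x : Fin n → ℝ} (hx : x ≠ 0) :
    matDeriv β P.F x = P.Fβ β x := by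
  ext i j
  rw [F_eq, matDeriv, Matrix.of_apply]
  exact mderiv_eq_of_pderiv (u := fun β x => P.Fβ β x i j)
    (fun β k => P.pderiv_Fβ hγ β i j k) β hx

theorem exists_frob_Fβ_le (hγ : (P.l : ℝ) < P.γnorm) (β : Fin n → ℕ) :
    ∃ C : ℝ, ∀ x : Fin n → ℝ, x ≠ 0 →
      frob (P.Fβ β x) ≤ C * P.ρ x ^ ((P.l : ℝ) - dot β P.γ - P.γnorm) := by
  choose C _ hC using fun i j => exists_norm_le (P.isHomog_Fβ hγ β i j)
  refine ⟨∑ i, ∑ j, C i j, fun x hx => (frob_le_sum _).trans ?_⟩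
  simp only [Finset.sum_mul]
  exact Finset.sum_le_sum fun i _ => Finset.sum_le_sum fun j _ => hC i j x hx

variable {P} in
theorem timeIntegral_sum {ι : Type*} (s : Finset ι) (c : ι → ℂ) {d : ℝ}
    {h : ι → (Fin n → ℝ) → ℂ} (H : ∀ a ∈ s, IsHomog P.γ d (h a)) (hd : 2 * P.l - P.γnorm < d)
    {x : Fin n → ℝ} (hx : x ≠ 0) :
    P.timeIntegral (fun z => ∑ a ∈ s, c a * h a z) x = ∑ a ∈ s, c a * P.timeIntegral (h a) x := by
  have hl := P.l_pos'
  have h1 : ∀ t ∈ Ioi (0 : ℝ), P.fourierHeat (fun z => ∑ a ∈ s, c a * h a z) x t =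
      ∑ a ∈ s, c a * P.fourierHeat (h a) x t := by
    intro t ht
    simp only [fourierHeat, ← integral_const_mul]
    rw [← integral_finsetSum]
    · refine integral_congr_ae (ae_of_all _ fun z => ?_)
      simp only [Finset.sum_mul, Finset.mul_sum]
      exact Finset.sum_congr rfl fun a _ => by ring
    · exact fun a ha => (integrable_phase_mul
        (integrable_mul_exp (H a ha) (by linarith) ht) x).const_mul _
  simp only [timeIntegral, ← integral_const_mul]
  rw [setIntegral_congr_fun measurableSet_Ioi h1, integral_finsetSum]
  exact fun a ha => (integrableOn_fourierHeat (H a ha) hd hx).const_mul _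

variable {P} in
theorem timeIntegral_congr {h h' : (Fin n → ℝ) → ℂ} (hh : ∀ z, z ≠ 0 → h z = h' z)
    (x : Fin n → ℝ) : P.timeIntegral h x = P.timeIntegral h' x := by
  have : ∀ t, P.fourierHeat h x t = P.fourierHeat h' x t := fun t =>
    integral_congr_ae ((ae_ne n).mono fun z hz => by simp only [hh z hz])
  simp only [timeIntegral, this]

/-- Since L L⁻¹ = 1 off the origin, the kernels combine to σ times the identity, and
`timeIntegral_σ` applies. All terms have degree 2ℓ because α·γ = ℓ, so the sum passes through the
integrals. -/
theorem act_F (hγ : (P.l : ℝ) < P.γnorm) {x : Fin n → ℝ} (hx : x ≠ 0) : P.act P.F x = 0 := by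
  have hl := P.l_pos'
  ext i j
  -- The right side is written as a one-term sum so that `timeIntegral_sum` also extracts its
  -- scalar.
  have h1 : ∀ z : Fin n → ℝ, z ≠ 0 →
      ∑ a ∈ indices P.l P.ls ×ˢ Finset.univ, P.A a.1 i a.2 * P.kernel a.1 a.2 j z =
        ∑ _a ∈ ({0} : Finset ℕ), (1 : Matrix (Fin m) (Fin m) ℂ) i j * (P.σ z : ℂ) := by
    intro z hz
    have h2 : (P.symbol z * (P.symbol z)⁻¹) i j = (1 : Matrix (Fin m) (Fin m) ℂ) i j := by
      rw [Matrix.mul_nonsing_inv _ (P.isUnit_det hz)]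
    rw [Finset.sum_singleton, ← h2, Matrix.mul_apply, Finset.sum_product_right, Finset.sum_mul]
    refine Finset.sum_congr rfl fun k _ => ?_
    rw [symbol, symbolOf, Matrix.sum_apply, Finset.sum_mul, Finset.sum_mul]
    refine Finset.sum_congr rfl fun α _ => ?_
    simp only [kernel, symbol, symbolOf, Matrix.smul_apply, smul_eq_mul]
    ring
  have h3 := timeIntegral_sum (P := P) (indices P.l P.ls ×ˢ Finset.univ)
    (fun a => P.A a.1 i a.2) (d := 2 * P.l) (h := fun a => P.kernel a.1 a.2 j)
    (fun a ha => by
      have := P.isHomog_kernel a.1 a.2 j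
      rwa [show dot a.1 P.γ = P.l from (mem_indices P.l_pos P.ls_pos _).1
        (Finset.mem_product.1 ha).1, ← two_mul] at this) (by linarith) hx
  rw [timeIntegral_congr h1, timeIntegral_sum _ _ (fun _ _ => P.isHomog_σ) (by linarith) hx,
    timeIntegral_σ hγ hx] at h3
  simp only [mul_zero, Finset.sum_const_zero, Finset.sum_product] at h3
  simp only [act, P.matDeriv_F hγ _ hx, Matrix.sum_apply, Matrix.mul_apply, Fβ_apply,
    Matrix.zero_apply]
  simp only [mul_left_comm (P.A _ _ _), ← Finset.mul_sum, ← h3, mul_zero]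

/-- Each γ_k ≤ ℓ, so ‖γ‖ ≤ nℓ. This supplies the second coordinate that integration by parts needs
to avoid the origin. -/
theorem one_lt_of_lt_γnorm {n m : ℕ} (P : SemiellipticOperator n m)
    (hγ : (P.l : ℝ) < P.γnorm) : 1 < n := by
  by_contra! hn
  have h1 : P.γnorm ≤ n * (P.l : ℝ) := by
    simpa [γnorm] using Finset.sum_le_sum fun (k : Fin n) (_ : k ∈ Finset.univ) => P.γ_le k
  have h2 : (n : ℝ) ≤ 1 := by exact_mod_cast hn
  nlinarith [P.l_pos']

end SemiellipticOperator

end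

theorem theorem3p1 {n m : ℕ} (P : SemiellipticOperator n m) (hγ : (P.l : ℝ) < P.γnorm) :
    -- (a) absolute convergence (inner and outer integral) and the bound
    (∀ β : Fin n → ℕ,
      (∀ x : Fin n → ℝ, x ≠ 0 → ∀ i j : Fin m,
        (∀ t : ℝ, 0 < t → Integrable (fun z : Fin n → ℝ => P.integrandβ β x t z i j)) ∧
        IntegrableOn (fun t : ℝ => P.Jβ β x t i j) (Ioi 0)) ∧
      ∃ C : ℝ, ∀ x : Fin n → ℝ, x ≠ 0 →
        Semielliptic.frob (P.Fβ β x) ≤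
          C * P.ρ x ^ ((P.l : ℝ) - Semielliptic.dot β P.γ - P.γnorm)) ∧
    -- (b) smoothness, and the formal derivatives are the derivatives
    ((∀ i j : Fin m, ContDiffOn ℝ ∞ (fun x => P.F x i j) {0}ᶜ) ∧
      ∀ β : Fin n → ℕ, ∀ x : Fin n → ℝ, x ≠ 0 → Semielliptic.matDeriv β P.F x = P.Fβ β x) ∧
    -- (c) anisotropic homogeneity
    (∀ β : Fin n → ℕ, ∀ s : ℝ, 0 < s → ∀ x : Fin n → ℝ,
      P.Fβ β (Semielliptic.dilate P.γ s x) =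
        s ^ ((P.l : ℝ) - Semielliptic.dot β P.γ - P.γnorm) • P.Fβ β x) ∧
    -- (d) the equation away from the origin
    (∀ x : Fin n → ℝ, x ≠ 0 → P.act P.F x = 0) := by
  have : Nontrivial (Fin n) := Fin.nontrivial_iff_two_le.2 (P.one_lt_of_lt_γnorm hγ)
  have hl := P.l_pos'
  have hd : ∀ β, 2 * P.l - P.γnorm < Semielliptic.dot β P.γ + P.l := fun β => by
    linarith [Semielliptic.dot_nonneg P.γ_pos β]
  refine ⟨fun β => ⟨fun x hx i j => ⟨fun t ht => ?_, ?_⟩, P.exists_frob_Fβ_le hγ β⟩,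
    ⟨fun i j => ?_, fun β x hx => P.matDeriv_F hγ β hx⟩, fun β s hs x => ?_,
    fun x hx => P.act_F hγ hx⟩
  · simp only [P.integrandβ_apply]
    exact SemiellipticOperator.integrable_phase_mul (SemiellipticOperator.integrable_mul_exp
      (P.isHomog_kernel β i j) (by linarith [hd β]) ht) x
  · simp only [P.Jβ_apply]
    exact SemiellipticOperator.integrableOn_fourierHeat (P.isHomog_kernel β i j) (hd β) hx
  · rw [P.F_eq]
    exact (P.isHomog_Fβ hγ 0 i j).smooth
  · ext i j
    rw [Matrix.smul_apply, P.Fβ_apply, P.Fβ_apply,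
      SemiellipticOperator.timeIntegral_dilate (P.isHomog_kernel β i j) hs x, Complex.real_smul,
      show 2 * P.l - P.γnorm - (Semielliptic.dot β P.γ + P.l) =
        P.l - Semielliptic.dot β P.γ - P.γnorm by ring]
    ring
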